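/- A convex polyhedron (a bounded intersection of finitely many half-spaces in $\mathbb R^3$, with non-empty interior) is called $k$-equiprojective if its orthogonal projection is a convex $k$-gon in every direction that is not parallel to one of its faces. Let $P$ be a pentagonal rotunda (half of a regular icosidodecahedron, of any size and position). Its base is a regular decagon, and each base edge lies in one further face, alternately a pentagon and a triangle. The edges of $P$ not on the base are partitioned into five planar paths of length five, each joining two opposite base vertices and each containing exactly one edge of the top pentagon. Let $\mathcal P_1,\dots,\mathcal P_5$ be these paths in the cyclic order of their edges on the top pentagon. The end points of $\mathcal P_1,\mathcal P_3$ are the end points of two opposite (parallel) base edges, and so are the end points of $\mathcal P_2,\mathcal P_4$. A cut of $P$ by a plane removes the part of $P$ on one side of the plane. Consider the following cuts. * cut1, at a base vertex $x$ which is an end of $\mathcal P_i$: the plane is perpendicular to the base and to the plane of $\mathcal P_i$, and $x$ is the only vertex of $P$ removed. * A pair of a cut2 and a cut3 at the ends of $\mathcal P_1,\mathcal P_3$ (or of $\mathcal P_2,\mathcal P_4$): let $e,e'$ be the two opposite base edges whose end points are the ends of the two paths, where $e$ lies in a pentagon $p$ and $e'$ in a triangle $t$. The plane of cut2 is parallel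 to $p$, and the vertices removed by it are exactly the end points of $e'$. The plane of cut3 is parallel to $t$, and the vertices removed by it are exactly the end points of $e$. * cut4, at a vertex $x$ not on the base: $x$ is the only vertex of $P$ removed, and the plane meets the four edges at $x$ in the corners of a rectangle. No cutting plane passes through a vertex of $P$, and the depths of the cuts are otherwise arbitrary, subject to the condition that the pieces cut off (with their boundaries) are pairwise disjoint. Let $P_1$ be any polyhedron obtained from $P$ by a cut4 at every vertex not on the base, a pair of a cut2 and a cut3 at the ends of $\mathcal P_1,\mathcal P_3$, a pair of a cut2 and a cut3 at the ends of $\mathcal P_2,\mathcal P_4$, and a cut1 at each of the two ends of $\mathcal P_5$. Let $P_2$ be any polyhedron obtained in the same way, except that the pair of a cut2 and a cut3 at the ends of $\mathcal P_2,\mathcal P_4$ is replaced by a cut1 at each of the four ends of $\mathcal P_2$ and $\mathcal P_4$. Then such $P_1$ and $P_2$ exist, every such $P_1$ is a 21-equiprojective convex polyhedron, and every such $P_2$ is a 23-equiprojective convex polyhedron. -/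

import Mathlib

open scoped goldenRatio

namespace EquiRotunda

/-- Euclidean three-space. -/
abbrev E3 : Type := EuclideanSpace ℝ (Fin 3)

/-! ### Convex polyhedra, faces, shadows, equiprojectivity -/

/-- A closed half-space `{x | ⟪normal, x⟫ ≤ level}` with outward normal `normal ≠ 0`. -/
structure HalfSpace where
  normal : E3
  normal_ne_zero : normal ≠ 0
  level : ℝ

/-- The points of the closed half-space. -/
def HalfSpace.carrier (h : HalfSpace) : Set E3 := {x | inner ℝ h.normal x ≤ h.level}

/-- The bounding plane of the half-space. -/
def HalfSpace.plane (h : HalfSpace) : Set E3 := {x | inner ℝ h.normal x = h.level}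

/-- The complementary closed half-space: what a cut along `h.plane` removes, together with
the plane itself. -/
def HalfSpace.coCarrier (h : HalfSpace) : Set E3 := {x | h.level ≤ inner ℝ h.normal x}

/-- A (bounded, full-dimensional) convex polyhedron: a finite intersection of half-spaces. -/
def IsConvexPolyhedron (P : Set E3) : Prop :=
  Bornology.IsBounded P ∧ (interior P).Nonempty ∧
    ∃ S : Set HalfSpace, S.Finite ∧ P = ⋂ h ∈ S, h.carrier

/-- `F` is a (two-dimensional) face of `P`. -/
def IsFace (P F : Set E3) : Prop :=
  IsExposed ℝ P F ∧ Module.finrank ℝ (vectorSpan ℝ F) = 2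

/-- The shadow of `P` in direction `u`: its orthogonal projection to the plane `uᗮ`. -/
noncomputable def shadow (u : E3) (P : Set E3) : Set E3 :=
  (ℝ ∙ u)ᗮ.starProjection '' P

/-- `Q` is a convex `k`-gon: two-dimensional, the convex hull of its extreme points
(corners), of which there are exactly `k`. -/
def IsConvexGon (k : ℕ) (Q : Set E3) : Prop :=
  Module.finrank ℝ (vectorSpan ℝ Q) = 2 ∧
    (Q.extremePoints ℝ).encard = k ∧ convexHull ℝ (Q.extremePoints ℝ) = Q

/-- `P` is a `k`-equiprojective convex polyhedron: its shadow is a `k`-gon in every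
direction that is not parallel to a face. -/
def IsEquiprojective (k : ℕ) (P : Set E3) : Prop :=
  IsConvexPolyhedron P ∧
    ∀ u : E3, u ≠ 0 → (∀ F, IsFace P F → u ∉ vectorSpan ℝ F) → IsConvexGon k (shadow u P)

/-! ### The pentagonal rotunda -/

/-- Labels of the twenty vertices of a pentagonal rotunda (indices cyclic modulo 5).
* The base decagon is `a 0, b 0, a 1, b 1, a 2, b 2, a 3, b 3, a 4, b 4`.
* Pentagon `i` is `a i, b i, m i, t i, m (i-1)`; it meets the base in the edge `a i, b i`.
* Triangle `i` is `b i, a (i+1), m i`; it meets the base in the edge `b i, a (i+1)`.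
* The upper triangles are `m i, t i, t (i+1)`.
* The top pentagon is `t 0, t 1, t 2, t 3, t 4`. -/
inductive Vert
  | a (i : Fin 5)
  | b (i : Fin 5)
  | m (i : Fin 5)
  | t (i : Fin 5)

open Vert

/-- The vertices of the pentagonal rotunda of edge length 2 which is the half
`{(x, y, z) | 0 ≤ φ * y + z}` of the regular icosidodecahedron whose vertices are the cyclic
permutations of `(±2φ, 0, 0)` and of `(±1, ±φ, ±φ²)`. -/
noncomputable def stdVert : Vert → E3
  | a i => ![!₂[2 * φ, 0, 0], !₂[1, φ, -φ ^ 2], !₂[-φ ^ 2, 1, -φ], !₂[-φ ^ 2, -1, φ],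
      !₂[1, -φ, φ ^ 2]] i
  | b i => ![!₂[φ ^ 2, 1, -φ], !₂[-1, φ, -φ ^ 2], !₂[-(2 * φ), 0, 0], !₂[-1, -φ, φ ^ 2],
      !₂[φ ^ 2, -1, φ]] i
  | m i => ![!₂[φ, φ ^ 2, -1], !₂[-φ, φ ^ 2, -1], !₂[-φ ^ 2, 1, φ], !₂[0, 0, 2 * φ],
      !₂[φ ^ 2, 1, φ]] i
  | t i => ![!₂[φ, φ ^ 2, 1], !₂[0, 2 * φ, 0], !₂[-φ, φ ^ 2, 1], !₂[-1, φ, φ ^ 2],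
      !₂[1, φ, φ ^ 2]] i

/-- `v` labels the vertices of a pentagonal rotunda: it is a similar copy (of any size, in any
position, possibly reflected) of the standard one. -/
def IsPentagonalRotunda (v : Vert → E3) : Prop :=
  ∃ f : E3 ≃ᵈ E3, ∀ k, v k = f (stdVert k)

/-- The solid rotunda with vertices `v`. -/
def solid (v : Vert → E3) : Set E3 := convexHull ℝ (Set.range v)

/-- The vertex labels of the base decagon. -/
def baseFace : Set Vert := Set.range a ∪ Set.range b

/-- The vertex labels of the `i`-th pentagon adjacent to the base. -/
def pentagon (i : Fin 5) : Set Vert := {a i, b i, m i, t i, m (i - 1)}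

/-- The vertex labels of the `i`-th triangle adjacent to the base. -/
def triangle (i : Fin 5) : Set Vert := {b i, a (i + 1), m i}

/-- The `i`-th of the five planar paths (each with five edges, from a base vertex to the opposite
base vertex) which partition the edges not on the base. Its middle edge, on the top pentagon, is
`t (i+1), t (i+2)`; so in the cyclic order of these edges, the paths `0, 1, 2, 3, 4` are
`𝒫₁, 𝒫₂, 𝒫₃, 𝒫₄, 𝒫₅`. -/
def path (i : Fin 5) : Fin 6 → Vert :=
  ![b i, m i, t (i + 1), t (i + 2), m (i + 2), a (i + 3)]

/-- The four neighbours, in cyclic order, of a vertex `m i`. -/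
def nbrM (i : Fin 5) : Fin 4 → Vert := ![b i, a (i + 1), t (i + 1), t i]

/-- The four neighbours, in cyclic order, of a vertex `t i`. -/
def nbrT (i : Fin 5) : Fin 4 → Vert := ![m (i - 1), m i, t (i + 1), t (i - 1)]

/-! ### Cuts -/

/-- Cutting along `h.plane` removes the vertices in `S` and no other vertex (and the plane passes
through no vertex). -/
def Removes (v : Vert → E3) (h : HalfSpace) (S : Set Vert) : Prop :=
  (∀ k ∈ S, h.level < inner ℝ h.normal (v k)) ∧ ∀ k ∉ S, inner ℝ h.normal (v k) < h.level

/-- The plane of `h` is parallel to the plane through the vertices `S`. -/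
def ParallelTo (v : Vert → E3) (h : HalfSpace) (S : Set Vert) : Prop :=
  h.normal ∈ (vectorSpan ℝ (v '' S))ᗮ

/-- The plane of `h` is perpendicular to the plane through the vertices `S`. -/
def PerpendicularTo (v : Vert → E3) (h : HalfSpace) (S : Set Vert) : Prop :=
  h.normal ∈ vectorSpan ℝ (v '' S)

/-- The points `q 0, q 1, q 2, q 3`, in this order, are the corners of a rectangle. -/
def IsRectangle (q : Fin 4 → E3) : Prop :=
  q 1 - q 0 = q 2 - q 3 ∧ inner ℝ (q 1 - q 0) (q 3 - q 0) = 0 ∧ q 1 ≠ q 0 ∧ q 3 ≠ q 0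

/-- The plane of `h` meets the four edges from `v k` to `v (w j)` in the corners of a rectangle. -/
def CutsRectangle (v : Vert → E3) (h : HalfSpace) (k : Vert) (w : Fin 4 → Vert) : Prop :=
  ∃ q : Fin 4 → E3, (∀ j, q j ∈ segment ℝ (v k) (v (w j)) ∩ h.plane) ∧ IsRectangle q

/-- Names for the cuts.
* `cut1start i`, `cut1stop i` are the cuts of the first type at the two ends of path `i`.
* `cut2 i`, `cut3 i` are the cuts of the second and third type that belong to the parallel base
edges `a i, b i` (of the pentagon `i`) and `b (i+2), a (i+3)` (of the triangle `i+2`). The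
endpoints of these two edges are the ends of the paths `i` and `i+2`.
* `cut4m i`, `cut4t i` are the cuts of the fourth type at the vertices `m i`, `t i`. -/
inductive CutName
  | cut1start (i : Fin 5)
  | cut1stop (i : Fin 5)
  | cut2 (i : Fin 5)
  | cut3 (i : Fin 5)
  | cut4m (i : Fin 5)
  | cut4t (i : Fin 5)

open CutName

/-- Cutting `solid v` along `h.plane` is a cut of the named type at the named place. -/
def IsCut (v : Vert → E3) (h : HalfSpace) : CutName → Prop
  | cut1start i =>
      PerpendicularTo v h baseFace ∧ PerpendicularTo v h (Set.range (path i)) ∧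
        Removes v h {path i 0}
  | cut1stop i =>
      PerpendicularTo v h baseFace ∧ PerpendicularTo v h (Set.range (path i)) ∧
        Removes v h {path i 5}
  | cut2 i => ParallelTo v h (pentagon i) ∧ Removes v h {b (i + 2), a (i + 3)}
  | cut3 i => ParallelTo v h (triangle (i + 2)) ∧ Removes v h {a i, b i}
  | cut4m i => CutsRectangle v h (m i) (nbrM i) ∧ Removes v h {m i}
  | cut4t i => CutsRectangle v h (t i) (nbrT i) ∧ Removes v h {t i}

/-- `P` is obtained from `solid v` by applying cuts with the names in `C`, the pieces that they
cut off being pairwise disjoint. -/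
def IsTruncation (v : Vert → E3) (C : Set CutName) (P : Set E3) : Prop :=
  ∃ h : CutName → HalfSpace,
    (∀ c ∈ C, IsCut v (h c) c) ∧
    C.PairwiseDisjoint (fun c => solid v ∩ (h c).coCarrier) ∧
    P = solid v ∩ ⋂ c ∈ C, (h c).carrier

/-- The cuts of the fourth type, at all vertices that are not on the base. -/
def upperCuts : Set CutName := Set.range cut4m ∪ Set.range cut4t

/-- The first equitruncated pentagonal rotunda: a pair of cut2 and cut3 at the ends of `𝒫₁` and
`𝒫₃`, another such pair at the ends of `𝒫₂` and `𝒫₄`, a pair of cut1 at the ends of `𝒫₅`, and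
a cut4 at every vertex that is not on the base. -/
def IsFirstEquitruncatedRotunda (v : Vert → E3) (P : Set E3) : Prop :=
  IsTruncation v
    ({cut2 0, cut3 0} ∪ {cut2 1, cut3 1} ∪ {cut1start 4, cut1stop 4} ∪ upperCuts) P

/-- The second equitruncated pentagonal rotunda: instead of the second pair of cut2 and cut3,
two pairs of cut1 at the ends of `𝒫₂` and of `𝒫₄`. -/
def IsSecondEquitruncatedRotunda (v : Vert → E3) (P : Set E3) : Prop :=
  IsTruncation v
    ({cut2 0, cut3 0} ∪ ({cut1start 1, cut1stop 1} ∪ {cut1start 3, cut1stop 3}) ∪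
      {cut1start 4, cut1stop 4} ∪ upperCuts) P

end EquiRotunda

/-!
The polytope is simple, so in a generic direction `u` the corners of the shadow are the images of
the vertices that lie on facets of both kinds, those facing `u` and those facing away from `u`. Such
a contour vertex is an end of exactly two edges at which the two facet normals are on different
sides of the plane orthogonal to `u`. Since every edge has two ends, the shadow has as many corners
as there are edges of this kind.

The edges of the polytope are partitioned into chains along which the facet normals turn, in a
plane, from some normal `p` to the opposite normal `-p`. A generic plane is crossed exactly once
during a half-turn, so each chain contains exactly one of the edges that are counted, for every
`u`: the polytope is equiprojective for the number of chains, which is 21 or 23.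

The normals of the cutting planes are determined up to positive factors by the kinds of the cuts.
Only the levels of the planes are free, and they do not influence the incidences. What is left is
finite and is decided by exact arithmetic in the ring `ℤ[φ]`, which contains the coordinates.
-/

namespace EquiRotunda

open scoped Matrix
open Vert CutName

section DualFamilies

variable {ι E : Type*} [NormedAddCommGroup E] [InnerProductSpace ℝ E] {n y : ι → E}

theorem inner_sum_smul_of_dual (h : ∀ i j, inner ℝ (n i) (y j) = 0 ↔ i ≠ j) (c : ι → ℝ)
    {s : Finset ι} {i : ι} (hi : i ∈ s) :
    inner ℝ (n i) (∑ j ∈ s, c j • y j) = c i * inner ℝ (n i) (y i) := by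
  rw [inner_sum, Finset.sum_eq_single_of_mem i hi, inner_smul_right]
  intro j _ hj
  rw [inner_smul_right, (h i j).2 hj.symm, mul_zero]

theorem linearIndependent_of_dual (h : ∀ i j, inner ℝ (n i) (y j) = 0 ↔ i ≠ j) :
    LinearIndependent ℝ y := by
  refine linearIndependent_iff'.2 fun s c hc i hi => ?_
  have hci := inner_sum_smul_of_dual h c hi
  rw [hc, inner_zero_right] at hci
  exact (mul_eq_zero.1 hci.symm).resolve_right fun h0 => (h i i).1 h0 rfl

theorem eq_sum_of_dual [Fintype ι] [FiniteDimensional ℝ E]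
    (hcard : Fintype.card ι = Module.finrank ℝ E)
    (h : ∀ i j, inner ℝ (n i) (y j) = 0 ↔ i ≠ j) (x : E) :
    x = ∑ j, (inner ℝ (n j) x / inner ℝ (n j) (y j)) • y j := by
  have hspan : Submodule.span ℝ (Set.range y) = ⊤ :=
    (linearIndependent_of_dual h).span_eq_top_of_card_eq_finrank' hcard
  obtain ⟨c, rfl⟩ := (Submodule.mem_span_range_iff_exists_fun ℝ).1
    (hspan ▸ Submodule.mem_top : x ∈ Submodule.span ℝ (Set.range y))
  refine Finset.sum_congr rfl fun j _ => ?_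
  rw [inner_sum_smul_of_dual h c (Finset.mem_univ j),
    mul_div_cancel_right₀ _ fun h0 => (h j j).1 h0 rfl]

end DualFamilies

section LinearImages

variable {E F : Type*} [AddCommGroup E] [Module ℝ E] [AddCommGroup F] [Module ℝ F]

theorem map_mem_extremePoints_image {P : Set E} {p : E} (hP : Convex ℝ P)
    (hp : p ∈ P.extremePoints ℝ) (T : E →ₗ[ℝ] F) (hfib : ∀ x ∈ P, T x = T p → x = p) :
    T p ∈ (T '' P).extremePoints ℝ := by
  refine mem_extremePoints_iff_left.2 ⟨⟨p, hp.1, rfl⟩, ?_⟩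
  rintro _ ⟨x, hx, rfl⟩ _ ⟨y, hy, rfl⟩ hxy
  obtain ⟨z, hz, hzp⟩ := (image_openSegment ℝ T.toAffineMap x y).ge hxy
  obtain rfl := hfib z (hP.openSegment_subset hx hy hz) hzp
  rw [hp.2 hx hy hz]

theorem map_notMem_extremePoints_image [TopologicalSpace E] [ContinuousAdd E]
    [ContinuousSMul ℝ E] {P : Set E} {p : E} (hp : p ∈ interior P) {T : E →ₗ[ℝ] F} (hT : T ≠ 0) :
    T p ∉ (T '' P).extremePoints ℝ := by
  obtain ⟨y, hy⟩ : ∃ y, T y ≠ 0 := by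
    by_contra! h
    exact hT (LinearMap.ext h)
  have hmem (z : E) : ∀ᶠ ε : ℝ in nhdsWithin 0 (Set.Ioi 0), p + ε • z ∈ P := by
    have hcont : Filter.Tendsto (fun ε : ℝ => p + ε • z) (nhds 0) (nhds p) :=
      Continuous.tendsto' (by fun_prop) _ _ (by simp)
    exact (hcont.eventually (mem_interior_iff_mem_nhds.1 hp)).filter_mono nhdsWithin_le_nhds
  obtain ⟨ε, ⟨hadd, hsub⟩, hε⟩ :=
    (((hmem y).and (hmem (-y))).and self_mem_nhdsWithin).exists
  intro hext
  have hmid : T p ∈ openSegment ℝ (T (p + ε • y)) (T (p + ε • -y)) :=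
    ⟨1 / 2, 1 / 2, by norm_num, by norm_num, by norm_num, by
      rw [← map_smul, ← map_smul, ← map_add]; congr 1; module⟩
  have heq := hext.2 ⟨_, hadd, rfl⟩ ⟨_, hsub, rfl⟩ hmid
  rw [map_add, add_eq_left, map_smul, smul_eq_zero] at heq
  exact heq.elim (ne_of_gt hε) hy

end LinearImages

section OpenSegments

variable {E : Type*} [NormedAddCommGroup E] [InnerProductSpace ℝ E] {n x y : E} {c : ℝ}

theorem exists_mem_openSegment_inner_eq (hx : c < inner ℝ n x) (hy : inner ℝ n y < c) :
    ∃ z ∈ openSegment ℝ x y, inner ℝ n z = c := by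
  refine (image_openSegment ℝ (innerₛₗ ℝ n).toAffineMap x y).ge ?_
  rw [openSegment_symm]
  exact (openSegment_eq_Ioo (hy.trans hx)).ge ⟨hy, hx⟩

theorem inner_eq_iff_of_mem_openSegment {z : E} (hx : inner ℝ n x ≤ c) (hy : inner ℝ n y ≤ c)
    (hz : z ∈ openSegment ℝ x y) : inner ℝ n z = c ↔ inner ℝ n x = c ∧ inner ℝ n y = c := by
  obtain ⟨s, t, hs, ht, hst, rfl⟩ := hz
  obtain rfl : t = 1 - s := eq_sub_of_add_eq' hst
  rw [inner_add_right, inner_smul_right, inner_smul_right]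
  refine ⟨fun h => ⟨?_, ?_⟩, fun ⟨h₁, h₂⟩ => by rw [h₁, h₂]; ring⟩ <;> nlinarith

end OpenSegments

theorem starProjection_orthogonal_singleton_eq_iff {E : Type*} [NormedAddCommGroup E]
    [InnerProductSpace ℝ E] {u x y : E} :
    (ℝ ∙ u)ᗮ.starProjection x = (ℝ ∙ u)ᗮ.starProjection y ↔ ∃ r : ℝ, x = y + r • u := by
  rw [← sub_eq_zero, ← map_sub, Submodule.starProjection_apply_eq_zero_iff,
    Submodule.orthogonal_orthogonal, Submodule.mem_span_singleton]
  exact exists_congr fun r => by rw [eq_sub_iff_add_eq, eq_comm, add_comm]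

theorem finrank_orthogonal_singleton {u : E3} (hu : u ≠ 0) :
    Module.finrank ℝ (ℝ ∙ u)ᗮ = 2 :=
  have : Fact (Module.finrank ℝ E3 = 2 + 1) := ⟨finrank_euclideanSpace_fin⟩
  Submodule.finrank_orthogonal_span_singleton hu

/-! ### Simple polytopes and their shadows -/

/-- A simple polytope in the space `E`, presented by its facets (labelled by `F`), its vertices
(labelled by `V`) and the incidence between them. A vertex lies on as many facets as the dimension
of `E`; `ι` is the index type for the facets at a vertex. -/
structure SimplePolytope (ι F V E : Type*) [Fintype ι] [NormedAddCommGroup E]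
    [InnerProductSpace ℝ E] where
  /-- The outward normals of the facets. -/
  normal : F → E
  /-- The levels of the facets. -/
  level : F → ℝ
  /-- The positions of the vertices. -/
  point : V → E
  /-- The facets at a vertex. -/
  facets : V → ι → F
  card_eq_finrank : Fintype.card ι = Module.finrank ℝ E
  inner_le (v : V) (f : F) : inner ℝ (normal f) (point v) ≤ level f
  inner_eq_iff (v : V) (f : F) :
    inner ℝ (normal f) (point v) = level f ↔ ∃ i, facets v i = f
  exists_adjacent (v : V) (i : ι) : ∃ w, ∀ j, (∃ k, facets w k = facets v j) ↔ j ≠ i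
  eq_of_facets (v w : V) : (∀ i, ∃ k, facets w k = facets v i) → v = w
  exists_vertex (f : F) : ∃ v i, facets v i = f

namespace SimplePolytope

section General

variable {ι F V E : Type*} [Fintype ι] [NormedAddCommGroup E] [InnerProductSpace ℝ E]
  (S : SimplePolytope ι F V E)

/-- The set of points of a simple polytope: the intersection of the half-spaces of its facets. -/
def body : Set E := {x | ∀ f, inner ℝ (S.normal f) x ≤ S.level f}

theorem point_mem_body (v : V) : S.point v ∈ S.body := S.inner_le v

theorem convex_body : Convex ℝ S.body := by
  rw [body, Set.ofPred_forall]
  exact convex_iInter fun f => convex_halfSpace_le (innerₛₗ ℝ (S.normal f)).isLinear _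

theorem inner_facets_point (v : V) (i : ι) :
    inner ℝ (S.normal (S.facets v i)) (S.point v) = S.level (S.facets v i) :=
  (S.inner_eq_iff v _).2 ⟨i, rfl⟩

/-- The vertex at the other end of the edge that leaves the facet `S.facets v i`. -/
noncomputable def adjacent (v : V) (i : ι) : V := (S.exists_adjacent v i).choose

/-- The vector along the edge at `v` that leaves the facet `S.facets v i`. -/
noncomputable def edge (v : V) (i : ι) : E := S.point (S.adjacent v i) - S.point v

theorem inner_facets_edge_eq_zero_iff (v : V) (i j : ι) :
    inner ℝ (S.normal (S.facets v i)) (S.edge v j) = 0 ↔ i ≠ j := by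
  rw [edge, inner_sub_right, S.inner_facets_point, sub_eq_zero, S.inner_eq_iff]
  exact (S.exists_adjacent v j).choose_spec i

theorem inner_facets_edge_nonpos (v : V) (i j : ι) :
    inner ℝ (S.normal (S.facets v i)) (S.edge v j) ≤ 0 := by
  rw [edge, inner_sub_right, S.inner_facets_point, sub_nonpos]
  exact S.inner_le _ _

theorem normal_ne_zero (f : F) : S.normal f ≠ 0 := by
  obtain ⟨v, i, rfl⟩ := S.exists_vertex f
  intro h
  refine (S.inner_facets_edge_eq_zero_iff v i i).1 ?_ rfl
  rw [h, inner_zero_left]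

theorem mem_interior_body_of_forall_lt [Finite F] {x : E}
    (hx : ∀ f, inner ℝ (S.normal f) x < S.level f) : x ∈ interior S.body := by
  refine mem_interior.2 ⟨{y | ∀ f, inner ℝ (S.normal f) y < S.level f}, fun y hy f => (hy f).le,
    ?_, hx⟩
  rw [Set.ofPred_forall]
  exact isOpen_iInter_of_finite fun f => isOpen_lt (by fun_prop) continuous_const

theorem exists_add_smul_mem_interior_body [Finite F] {v : V} {u : E}
    (hu : ∀ i, inner ℝ (S.normal (S.facets v i)) u < 0) :
    ∃ ε : ℝ, S.point v + ε • u ∈ interior S.body := by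
  suffices h : ∀ᶠ ε : ℝ in nhdsWithin 0 (Set.Ioi 0),
      ∀ f, inner ℝ (S.normal f) (S.point v + ε • u) < S.level f from
    h.exists.imp fun ε => S.mem_interior_body_of_forall_lt
  refine Filter.eventually_all.2 fun f => ?_
  by_cases hf : ∃ i, S.facets v i = f
  · obtain ⟨i, rfl⟩ := hf
    filter_upwards [self_mem_nhdsWithin] with ε hε
    rw [inner_add_right, inner_smul_right, S.inner_facets_point]
    exact add_lt_of_neg_right _ (mul_neg_of_pos_of_neg hε (hu i))
  · have hlt : inner ℝ (S.normal f) (S.point v) < S.level f :=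
      (S.inner_le v f).lt_of_ne fun h => hf ((S.inner_eq_iff v f).1 h)
    have hcont : Filter.Tendsto (fun ε : ℝ => inner ℝ (S.normal f) (S.point v + ε • u))
        (nhds 0) (nhds (inner ℝ (S.normal f) (S.point v))) :=
      Continuous.tendsto' (by fun_prop) _ _ (by simp)
    exact (hcont.eventually (gt_mem_nhds hlt)).filter_mono nhdsWithin_le_nhds

/-- The face of the polytope in the bounding hyperplane of a facet. -/
def face (f : F) : Set E := {x ∈ S.body | inner ℝ (S.normal f) x = S.level f}

theorem isExposed_face (f : F) : IsExposed ℝ S.body (S.face f) := by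
  refine fun _ => ⟨innerSL ℝ (S.normal f), ?_⟩
  obtain ⟨v, i, rfl⟩ := S.exists_vertex f
  ext x
  refine and_congr_right fun hx => ⟨fun h y hy => (hy _).trans_eq h.symm, fun h => ?_⟩
  exact (hx _).antisymm (S.inner_facets_point v i ▸ h _ (S.point_mem_body v))

/-- The vertex `v` is on the contour of the polytope in direction `u`: there are facets at `v` on
both sides of the direction. -/
def IsContour (u : E) (v : V) : Prop :=
  (∃ i, inner ℝ (S.normal (S.facets v i)) u < 0) ∧ ∃ i, 0 < inner ℝ (S.normal (S.facets v i)) u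

variable {S} in
theorem IsContour.eq_of_starProjection_eq {u : E} {v : V} (hv : S.IsContour u v) {x : E}
    (hx : x ∈ S.body)
    (h : (ℝ ∙ u)ᗮ.starProjection x = (ℝ ∙ u)ᗮ.starProjection (S.point v)) : x = S.point v := by
  obtain ⟨r, rfl⟩ := starProjection_orthogonal_singleton_eq_iff.1 h
  have hr (k : ι) : r * inner ℝ (S.normal (S.facets v k)) u ≤ 0 := by
    have := hx (S.facets v k)
    rwa [inner_add_right, inner_smul_right, S.inner_facets_point, add_le_iff_nonpos_right] at this
  obtain ⟨⟨i, hi⟩, j, hj⟩ := hv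
  have hr0 : r = 0 := (nonpos_of_mul_nonpos_left (hr j) hj).antisymm
    (nonneg_of_mul_nonpos_left (hr i) hi)
  rw [hr0, zero_smul, add_zero]

theorem injOn_starProjection_contour (u : E) :
    Set.InjOn (fun v => (ℝ ∙ u)ᗮ.starProjection (S.point v)) {v | S.IsContour u v} := by
  intro v hv w _ h
  have hvw := hv.eq_of_starProjection_eq (S.point_mem_body w) h.symm
  exact S.eq_of_facets v w fun i => (S.inner_eq_iff w _).1 (hvw ▸ S.inner_facets_point v i)

theorem isContour_of_mem_extremePoints [Finite F] {u : E}
    (hu : ∀ f, inner ℝ (S.normal f) u ≠ 0) (htop : (ℝ ∙ u)ᗮ ≠ ⊥) {v : V}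
    (hv : (ℝ ∙ u)ᗮ.starProjection (S.point v) ∈
      ((ℝ ∙ u)ᗮ.starProjection '' S.body).extremePoints ℝ) : S.IsContour u v := by
  have hT : ((ℝ ∙ u)ᗮ.starProjection : E →ₗ[ℝ] E) ≠ 0 := fun h => htop <| by
    rw [← Submodule.range_starProjection (ℝ ∙ u)ᗮ]
    exact LinearMap.range_eq_bot.2 h
  have key (s : ℝ) : ¬ ∀ i, inner ℝ (S.normal (S.facets v i)) (s • u) < 0 := fun hs => by
    obtain ⟨ε, hε⟩ := S.exists_add_smul_mem_interior_body hs
    refine map_notMem_extremePoints_image hε hT ?_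
    convert! hv using 1
    exact starProjection_orthogonal_singleton_eq_iff.2 ⟨ε * s, by rw [mul_smul]⟩
  refine ⟨?_, ?_⟩ <;> by_contra! h
  · exact key (-1) fun i => by
      rw [neg_one_smul, inner_neg_right, neg_neg_iff_pos]
      exact (h i).lt_of_ne (hu _).symm
  · exact key 1 fun i => by
      rw [one_smul]
      exact (h i).lt_of_ne (hu _)

variable [FiniteDimensional ℝ E]

theorem eq_sum_edge (v : V) (x : E) :
    x = ∑ j, (inner ℝ (S.normal (S.facets v j)) x /
      inner ℝ (S.normal (S.facets v j)) (S.edge v j)) • S.edge v j :=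
  eq_sum_of_dual S.card_eq_finrank (S.inner_facets_edge_eq_zero_iff v) x

theorem eq_zero_of_inner_facets {v : V} {x : E}
    (h : ∀ i, inner ℝ (S.normal (S.facets v i)) x = 0) : x = 0 := by
  rw [S.eq_sum_edge v x]
  simp only [h, zero_div, zero_smul, Finset.sum_const_zero]

theorem point_mem_extremePoints_body (v : V) : S.point v ∈ S.body.extremePoints ℝ := by
  refine mem_extremePoints_iff_left.2 ⟨S.point_mem_body v, fun x hx y hy hxy => ?_⟩
  refine sub_eq_zero.1 (S.eq_zero_of_inner_facets (v := v) fun i => ?_)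
  obtain ⟨a, b, ha, hb, hab, hv⟩ := hxy
  have hx := hx (S.facets v i)
  have hy := hy (S.facets v i)
  have hlevel := S.inner_facets_point v i
  rw [← hv, inner_add_right, inner_smul_right, inner_smul_right] at hlevel
  rw [inner_sub_right, S.inner_facets_point, sub_eq_zero]
  refine hx.antisymm ?_
  have hb' : b = 1 - a := by linarith
  subst hb'
  nlinarith

theorem body_eq_convexHull [Finite V] [Nonempty V] :
    S.body = convexHull ℝ (Set.range S.point) := by
  refine Set.Subset.antisymm (fun x hx => ?_)
    (convexHull_min (Set.range_subset_iff.2 S.point_mem_body) S.convex_body)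
  by_contra hx'
  obtain ⟨l, c, hlt, hgt⟩ := geometric_hahn_banach_closed_point (convex_convexHull ℝ _)
    ((Set.finite_range S.point).isClosed_convexHull ℝ) hx'
  obtain ⟨v, hv⟩ := Finite.exists_max fun v => l (S.point v)
  have hle : l (x - S.point v) ≤ 0 := by
    rw [S.eq_sum_edge v (x - S.point v), map_sum]
    refine Finset.sum_nonpos fun j _ => ?_
    rw [map_smul, smul_eq_mul]
    refine mul_nonpos_of_nonneg_of_nonpos
      (div_nonneg_of_nonpos ?_ (S.inner_facets_edge_nonpos v j j)) ?_
    · rw [inner_sub_right, S.inner_facets_point, sub_nonpos]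
      exact hx _
    · rw [edge, map_sub, sub_nonpos]
      exact hv _
  rw [map_sub, sub_nonpos] at hle
  exact (hlt _ (subset_convexHull ℝ _ ⟨v, rfl⟩)).not_ge (hgt.le.trans hle)

theorem isCompact_body [Finite V] [Nonempty V] : IsCompact S.body := by
  rw [S.body_eq_convexHull]
  exact (Set.finite_range S.point).isCompact_convexHull ℝ

theorem vectorSpan_body [Nonempty V] : vectorSpan ℝ S.body = ⊤ := by
  obtain ⟨v⟩ := ‹Nonempty V›
  refine eq_top_iff.2 fun x _ => ?_
  rw [S.eq_sum_edge v x]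
  exact Submodule.sum_mem _ fun j _ => Submodule.smul_mem _ _
    (vsub_mem_vectorSpan ℝ (S.point_mem_body _) (S.point_mem_body _))

theorem nonempty_interior_body [Nonempty V] : (interior S.body).Nonempty := by
  have hne : S.body.Nonempty := ‹Nonempty V›.elim fun v => ⟨_, S.point_mem_body v⟩
  rw [S.convex_body.interior_nonempty_iff_affineSpan_eq_top,
    AffineSubspace.affineSpan_eq_top_iff_vectorSpan_eq_top_of_nonempty _ _ _ hne]
  exact S.vectorSpan_body

theorem vectorSpan_face (f : F) : vectorSpan ℝ (S.face f) = (ℝ ∙ S.normal f)ᗮ := by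
  refine le_antisymm (Submodule.span_le.2 ?_) fun x hx => ?_
  · rintro _ ⟨x, hx, y, hy, rfl⟩
    rw [SetLike.mem_coe, Submodule.mem_orthogonal_singleton_iff_inner_right]
    exact (inner_sub_right _ _ _).trans (by rw [hx.2, hy.2, sub_self])
  · rw [Submodule.mem_orthogonal_singleton_iff_inner_right] at hx
    obtain ⟨v, i, rfl⟩ := S.exists_vertex f
    rw [S.eq_sum_edge v x]
    refine Submodule.sum_mem _ fun j _ => ?_
    obtain rfl | hij := eq_or_ne i j
    · rw [hx, zero_div, zero_smul]
      exact Submodule.zero_mem _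
    · have hedge := (S.inner_facets_edge_eq_zero_iff v i j).2 hij
      rw [edge, inner_sub_right, S.inner_facets_point, sub_eq_zero] at hedge
      exact Submodule.smul_mem _ _ (vsub_mem_vectorSpan ℝ ⟨S.point_mem_body _, hedge⟩
        ⟨S.point_mem_body _, S.inner_facets_point _ _⟩)

theorem extremePoints_image_starProjection [Finite F] [Finite V] [Nonempty V] {u : E}
    (hu : ∀ f, inner ℝ (S.normal f) u ≠ 0) (htop : (ℝ ∙ u)ᗮ ≠ ⊥) :
    ((ℝ ∙ u)ᗮ.starProjection '' S.body).extremePoints ℝ =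
      (fun v => (ℝ ∙ u)ᗮ.starProjection (S.point v)) '' {v | S.IsContour u v} := by
  refine Set.Subset.antisymm (fun z hz => ?_) ?_
  · have himage : (ℝ ∙ u)ᗮ.starProjection '' S.body = convexHull ℝ
        ((ℝ ∙ u)ᗮ.starProjection.toLinearMap '' Set.range S.point) := by
      rw [← LinearMap.image_convexHull, ← S.body_eq_convexHull]
      rfl
    obtain ⟨_, ⟨v, rfl⟩, rfl⟩ := extremePoints_convexHull_subset (himage ▸ hz)
    exact ⟨v, S.isContour_of_mem_extremePoints hu htop hz, rfl⟩
  · rintro _ ⟨v, hv, rfl⟩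
    exact map_mem_extremePoints_image S.convex_body (S.point_mem_extremePoints_body v)
      (ℝ ∙ u)ᗮ.starProjection.toLinearMap fun x => hv.eq_of_starProjection_eq

end General

section ThreeDimensional

variable {F V : Type*} (S : SimplePolytope (Fin 3) F V E3)

theorem isConvexPolyhedron_body [Finite F] [Finite V] [Nonempty V] :
    IsConvexPolyhedron S.body := by
  refine ⟨S.isCompact_body.isBounded, S.nonempty_interior_body,
    Set.range fun f => ⟨S.normal f, S.normal_ne_zero f, S.level f⟩, Set.finite_range _, ?_⟩
  simp only [body, Set.ofPred_forall, Set.biInter_range, HalfSpace.carrier]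

theorem isFace_face (f : F) : IsFace S.body (S.face f) :=
  ⟨S.isExposed_face f, by
    rw [S.vectorSpan_face, finrank_orthogonal_singleton (S.normal_ne_zero f)]⟩

theorem isConvexGon_shadow [Finite F] [Finite V] [Nonempty V] {u : E3} (hu0 : u ≠ 0)
    (hu : ∀ f, inner ℝ (S.normal f) u ≠ 0) :
    IsConvexGon {v | S.IsContour u v}.ncard (shadow u S.body) := by
  have hrank := finrank_orthogonal_singleton hu0
  have htop : (ℝ ∙ u)ᗮ ≠ ⊥ := fun h => by
    rw [h, finrank_bot] at hrank
    exact absurd hrank (by decide)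
  have hext := S.extremePoints_image_starProjection hu htop
  refine ⟨?_, ?_, ?_⟩
  · have hspan := (((ℝ ∙ u)ᗮ.starProjection.toLinearMap).toAffineMap).map_vectorSpan (s := S.body)
    rw [S.vectorSpan_body, Submodule.map_top] at hspan
    rw [← hrank]
    exact congrArg (fun A : Submodule ℝ E3 => Module.finrank ℝ A)
      (hspan.symm.trans (Submodule.range_starProjection _))
  · rw [shadow, hext, (S.injOn_starProjection_contour u).encard_image,
      ← (Set.toFinite _).cast_ncard_eq]
  · have hcompact : IsCompact (shadow u S.body) :=
      S.isCompact_body.image (ContinuousLinearMap.continuous _)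
    have hconvex : Convex ℝ (shadow u S.body) :=
      S.convex_body.linear_image (ℝ ∙ u)ᗮ.starProjection.toLinearMap
    have hfin : ((shadow u S.body).extremePoints ℝ).Finite := by
      rw [shadow, hext]
      exact (Set.toFinite _).image _
    exact (hfin.isClosed_convexHull ℝ).closure_eq.symm.trans
      (closure_convexHull_extremePoints hcompact hconvex)

theorem isEquiprojective_body [Finite F] [Finite V] [Nonempty V] {k : ℕ}
    (hk : ∀ u : E3, (∀ f, inner ℝ (S.normal f) u ≠ 0) → {v | S.IsContour u v}.ncard = k) :
    IsEquiprojective k S.body := by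
  refine ⟨S.isConvexPolyhedron_body, fun u hu0 hu => ?_⟩
  have hgeneric (f : F) : inner ℝ (S.normal f) u ≠ 0 := fun h =>
    hu _ (S.isFace_face f) (by
      rwa [S.vectorSpan_face, Submodule.mem_orthogonal_singleton_iff_inner_right])
  exact hk u hgeneric ▸ S.isConvexGon_shadow hu0 hgeneric

end ThreeDimensional

end SimplePolytope

/-! ### Half-turns -/

section HalfTurns

variable {E : Type*} [NormedAddCommGroup E] [InnerProductSpace ℝ E]

/-- The number, `0` or `1`, of sign changes of the functional `⟪·, u⟫` on a pair of vectors. -/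
noncomputable def signChange (u : E) : Sym2 E → ℕ :=
  Sym2.lift ⟨fun p q => if SignType.sign (inner ℝ p u) = SignType.sign (inner ℝ q u) then 0 else 1,
    fun p q => by simp only [eq_comm]⟩

theorem signChange_mk (u p q : E) : signChange u s(p, q) =
    if SignType.sign (inner ℝ p u) = SignType.sign (inner ℝ q u) then 0 else 1 := rfl

/-- A rotation by at most a half-turn from `p` to `r`, within a plane, passes `q`. -/
def IsBetween (p q r : E) : Prop := r = -p ∨ ∃ a b : ℝ, 0 ≤ a ∧ 0 ≤ b ∧ q = a • p + b • r

theorem IsBetween.signChange_add {p q r u : E} (h : IsBetween p q r) (hp : inner ℝ p u ≠ 0)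
    (hq : inner ℝ q u ≠ 0) (hr : inner ℝ r u ≠ 0) :
    signChange u s(p, q) + signChange u s(q, r) = signChange u s(p, r) := by
  obtain rfl | ⟨a, b, ha, hb, rfl⟩ := h
  · simp only [signChange_mk, inner_neg_left, Left.sign_neg]
    obtain hp | hp := hp.lt_or_gt <;> obtain hq | hq := hq.lt_or_gt <;> simp [hp, hq]
  · have hpos : 0 < inner ℝ p u → 0 < inner ℝ r u → 0 < inner ℝ (a • p + b • r) u := fun hp hr => by
      refine hq.symm.lt_of_le ?_
      rw [inner_add_left, real_inner_smul_left, real_inner_smul_left]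
      positivity
    have hneg : inner ℝ p u < 0 → inner ℝ r u < 0 → inner ℝ (a • p + b • r) u < 0 :=
      fun hp hr => by
        refine hq.lt_of_le ?_
        rw [inner_add_left, real_inner_smul_left, real_inner_smul_left]
        exact add_nonpos (mul_nonpos_of_nonneg_of_nonpos ha hp.le)
          (mul_nonpos_of_nonneg_of_nonpos hb hr.le)
    simp only [signChange_mk]
    obtain hp | hp := hp.lt_or_gt <;> obtain hr | hr := hr.lt_or_gt
    · simp [hp, hr, hneg hp hr]
    · obtain hq | hq := hq.lt_or_gt <;> simp [hp, hq, hr]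
    · obtain hq | hq := hq.lt_or_gt <;> simp [hp, hq, hr]
    · simp [hp, hr, hpos hp hr]

theorem signChange_self_neg {p u : E} (hp : inner ℝ p u ≠ 0) : signChange u s(p, -p) = 1 := by
  rw [signChange_mk, inner_neg_left, Left.sign_neg]
  obtain hp | hp := hp.lt_or_gt <;> simp [hp]

/-- A list whose first entry `p` and last entry `-p` are opposite and in which, according to the
relation `R`, any entry lies between the first one and the next one. -/
def IsHalfTurnWith {α : Type*} [Neg α] (R : α → α → α → Prop) : List α → Prop
  | [] => False
  | p :: l => l.IsChain (R p) ∧ -p ∈ l.getLast?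

instance {α : Type*} [Neg α] [DecidableEq α] (R : α → α → α → Prop)
    [∀ p q r, Decidable (R p q r)] : DecidablePred (IsHalfTurnWith R)
  | [] => instDecidableFalse
  | p :: l => inferInstanceAs (Decidable (l.IsChain (R p) ∧ -p ∈ l.getLast?))

theorem IsHalfTurnWith.map {α β : Type*} [Neg α] [Neg β] {R : α → α → α → Prop}
    {S : β → β → β → Prop} (f : α → β) (hf : ∀ p, f (-p) = -f p)
    (hRS : ∀ p q r, R p q r → S (f p) (f q) (f r)) {l : List α} (hl : IsHalfTurnWith R l) :
    IsHalfTurnWith S (l.map f) := by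
  obtain _ | ⟨p, l⟩ := l
  · exact hl
  · refine ⟨(List.isChain_map f).2 (hl.1.imp fun q r => hRS p q r), ?_⟩
    rw [List.getLast?_map, Option.mem_def, hl.2, Option.map_some, hf]

/-- The unordered pairs of neighbouring entries of a list. -/
def consecutivePairs {α : Type*} (l : List α) : List (Sym2 α) := l.zipWith (s(·, ·)) l.tail

theorem map_consecutivePairs {α β : Type*} (f : α → β) (l : List α) :
    (consecutivePairs l).map (Sym2.map f) = consecutivePairs (l.map f) := by
  simp only [consecutivePairs, List.map_zipWith, Sym2.map_mk, List.zipWith_map, ← List.map_tail]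

theorem consecutivePairs_cons_cons {α : Type*} (p q : α) (l : List α) :
    consecutivePairs (p :: q :: l) = s(p, q) :: consecutivePairs (q :: l) := rfl

theorem signChange_add_sum_consecutivePairs {u p q r : E} {l : List E} (hp : inner ℝ p u ≠ 0)
    (hl : ∀ x ∈ q :: l, inner ℝ x u ≠ 0) (hchain : (q :: l).IsChain (IsBetween p))
    (hlast : r ∈ (q :: l).getLast?) :
    signChange u s(p, q) + ((consecutivePairs (q :: l)).map (signChange u)).sum =
      signChange u s(p, r) := by
  induction l generalizing q with
  | nil =>
    obtain rfl : q = r := by simpa using hlast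
    rfl
  | cons x l ih =>
    obtain ⟨hq, hl⟩ := List.forall_mem_cons.1 hl
    obtain ⟨hbetween, hchain⟩ := List.isChain_cons_cons.1 hchain
    rw [consecutivePairs_cons_cons, List.map_cons, List.sum_cons, ← add_assoc,
      hbetween.signChange_add hp hq (hl x List.mem_cons_self)]
    exact ih hl hchain (List.getLast?_cons_cons ▸ hlast)

theorem IsHalfTurnWith.sum_signChange {u : E} {l : List E} (h : IsHalfTurnWith IsBetween l)
    (hne : ∀ p ∈ l, inner ℝ p u ≠ 0) :
    ((consecutivePairs l).map (signChange u)).sum = 1 := by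
  obtain _ | ⟨p, _ | ⟨q, l⟩⟩ := l
  · exact h.elim
  · exact absurd h.2 (by simp)
  · obtain ⟨hp, hl⟩ := List.forall_mem_cons.1 hne
    rw [consecutivePairs_cons_cons, List.map_cons, List.sum_cons,
      signChange_add_sum_consecutivePairs hp hl h.1 h.2, signChange_self_neg hp]

end HalfTurns

namespace SimplePolytope

variable {F V : Type*} (S : SimplePolytope (Fin 3) F V E3)

/-- The three pairs of facet normals at a vertex; each of them belongs to an edge that ends there,
so that every edge of the polytope occurs at exactly two vertices. -/
def cornerPairs (v : V) : Multiset (Sym2 E3) :=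
  {s(S.normal (S.facets v 0), S.normal (S.facets v 1)),
    s(S.normal (S.facets v 1), S.normal (S.facets v 2)),
    s(S.normal (S.facets v 2), S.normal (S.facets v 0))}

open Classical in
theorem sum_signChange_cornerPairs {u : E3} (hu : ∀ f, inner ℝ (S.normal f) u ≠ 0) (v : V) :
    ((S.cornerPairs v).map (signChange u)).sum = if S.IsContour u v then 2 else 0 := by
  simp only [cornerPairs, IsContour, Fin.exists_fin_succ, Multiset.insert_eq_cons]
  obtain h₀ | h₀ := (hu (S.facets v 0)).lt_or_gt <;>
  obtain h₁ | h₁ := (hu (S.facets v 1)).lt_or_gt <;>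
  obtain h₂ | h₂ := (hu (S.facets v 2)).lt_or_gt <;>
  simp [signChange_mk, h₀, h₁, h₂, h₀.not_gt, h₁.not_gt, h₂.not_gt]

theorem ncard_isContour [Fintype V] {L : List (List E3)}
    (hL : ∀ l ∈ L, IsHalfTurnWith IsBetween l ∧ ∀ p ∈ l, p ∈ Set.range S.normal)
    (hpairs : ∑ v, S.cornerPairs v = 2 • (L.flatMap consecutivePairs : Multiset (Sym2 E3)))
    {u : E3} (hu : ∀ f, inner ℝ (S.normal f) u ≠ 0) :
    {v | S.IsContour u v}.ncard = L.length := by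
  classical
  have hturn : ((L.flatMap consecutivePairs).map (signChange u)).sum = L.length := by
    rw [List.map_flatMap, List.flatMap, List.sum_flatten, List.map_map,
      List.map_congr_left (g := fun _ => 1) fun l hl => ?_]
    · simp
    · refine (hL l hl).1.sum_signChange fun p hp => ?_
      obtain ⟨f, rfl⟩ := (hL l hl).2 p hp
      exact hu f
  have htotal := congrArg
    (Multiset.sumAddMonoidHom.comp (Multiset.mapAddMonoidHom (signChange u))) hpairs
  rw [map_sum, map_nsmul] at htotal
  simp only [AddMonoidHom.comp_apply, Multiset.coe_mapAddMonoidHom,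
    Multiset.coe_sumAddMonoidHom, S.sum_signChange_cornerPairs hu, Multiset.map_coe,
    Multiset.sum_coe, hturn, ← Finset.sum_filter, Finset.sum_const, smul_eq_mul] at htotal
  rw [Set.ncard_eq_toFinset_card', Set.toFinset_ofPred]
  lia

theorem isEquiprojective_length [Finite F] [Fintype V] [Nonempty V] {L : List (List E3)}
    (hL : ∀ l ∈ L, IsHalfTurnWith IsBetween l ∧ ∀ p ∈ l, p ∈ Set.range S.normal)
    (hpairs : ∑ v, S.cornerPairs v = 2 • (L.flatMap consecutivePairs : Multiset (Sym2 E3))) :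
    IsEquiprojective L.length S.body :=
  S.isEquiprojective_body fun _ => S.ncard_isContour hL hpairs

end SimplePolytope

/-! ### Exact arithmetic -/

theorem strictMono_mul_abs : StrictMono fun t : ℝ => t * |t| := by
  intro s t hst
  obtain hs | hs := lt_or_ge s 0 <;> obtain ht | ht := le_or_gt 0 t <;>
    simp only [abs_of_nonneg, abs_of_neg, hs, ht] <;> nlinarith

/-- The ring `ℤ[φ]`; the element `⟨x, y⟩` is `x + y * φ`. The coordinates of the rotunda and of the
facet normals are in this ring, in which inequalities can be decided. -/
abbrev GoldenInt : Type := QuadraticAlgebra ℤ 1 1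

namespace GoldenInt

/-- The embedding of `ℤ[φ]` into the real numbers. -/
noncomputable def toReal : GoldenInt →+* ℝ :=
  (QuadraticAlgebra.lift ⟨φ, by
    rw [← sq, Real.goldenRatio_sq, one_smul, one_smul, add_comm]⟩ : GoldenInt →ₐ[ℤ] ℝ)

theorem toReal_apply (x : GoldenInt) : toReal x = x.re + x.im * φ := by
  change x.re • (1 : ℝ) + x.im • φ = _
  rw [zsmul_one, zsmul_eq_mul]

theorem toReal_injective : Function.Injective toReal := by
  refine (injective_iff_map_eq_zero _).2 fun x hx => ?_
  rw [toReal_apply] at hx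
  have him : x.im = 0 := by
    by_contra him
    exact (Real.goldenRatio_irrational.intCast_mul him).intCast_add x.re ⟨0, by simp [hx]⟩
  refine QuadraticAlgebra.ext ?_ him
  simpa [him] using hx

noncomputable instance : Preorder GoldenInt := Preorder.lift toReal

theorem le_iff {x y : GoldenInt} : x ≤ y ↔ toReal x ≤ toReal y := Iff.rfl

theorem lt_iff {x y : GoldenInt} : x < y ↔ toReal x < toReal y := Iff.rfl

-- The claim is `-(x.im * √5) < 2 * x.re + x.im`, with `t ↦ t * |t|` applied to both sides.
theorem toReal_pos_iff (x : GoldenInt) :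
    0 < toReal x ↔ 0 < (2 * x.re + x.im) * |2 * x.re + x.im| + 5 * (x.im * |x.im|) := by
  have hx : 2 * toReal x = (2 * x.re + x.im : ℤ) + x.im * √5 := by
    rw [toReal_apply, Real.goldenRatio]
    push_cast
    ring
  have hsq : -(x.im * √5) * |-(x.im * √5)| = -(5 * (x.im * |(x.im : ℝ)|)) := by
    rw [abs_neg, abs_mul, abs_of_nonneg (Real.sqrt_nonneg 5)]
    linear_combination (-(x.im * |(x.im : ℝ)|)) * Real.mul_self_sqrt (show (0 : ℝ) ≤ 5 by norm_num)
  rw [← mul_pos_iff_of_pos_left two_pos, hx, ← neg_lt_iff_pos_add, ← strictMono_mul_abs.lt_iff_lt]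
  simp only [hsq]
  rw [neg_lt_iff_pos_add]
  exact_mod_cast Iff.rfl

instance : DecidableLT GoldenInt := fun x y =>
  decidable_of_iff (0 < (2 * (y - x).re + (y - x).im) * |2 * (y - x).re + (y - x).im| +
      5 * ((y - x).im * |(y - x).im|)) <| by
    rw [← toReal_pos_iff, map_sub, sub_pos, lt_iff]

instance : DecidableLE GoldenInt := fun x y =>
  decidable_of_iff (¬ y < x) <| by rw [lt_iff, not_lt, le_iff]

end GoldenInt

/-! ### The rotunda in coordinates -/

/-- Vectors with coordinates in `ℤ[φ]`. -/
abbrev GoldenVec : Type := Fin 3 → GoldenInt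

/-- The embedding of `ℤ[φ]³` in Euclidean space. -/
noncomputable def goldenEmbedding : GoldenVec →ₛₗ[GoldenInt.toReal] E3 where
  toFun p := WithLp.toLp 2 fun i => (p i).toReal
  map_add' p q := by
    ext i
    exact map_add _ _ _
  map_smul' x p := by
    ext i
    exact map_mul _ _ _

theorem inner_goldenEmbedding (p q : GoldenVec) :
    inner ℝ (goldenEmbedding p) (goldenEmbedding q) = (p ⬝ᵥ q).toReal := by
  rw [RingHom.map_dotProduct, dotProduct_comm, EuclideanSpace.inner_eq_star_dotProduct]
  rfl

/-- The coordinates of the vertices of the standard rotunda. -/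
def coord : Vert → GoldenVec
  | a i => ![![⟨0, 2⟩, 0, 0], ![1, ⟨0, 1⟩, ⟨-1, -1⟩], ![⟨-1, -1⟩, 1, ⟨0, -1⟩],
      ![⟨-1, -1⟩, -1, ⟨0, 1⟩], ![1, ⟨0, -1⟩, ⟨1, 1⟩]] i
  | b i => ![![⟨1, 1⟩, 1, ⟨0, -1⟩], ![-1, ⟨0, 1⟩, ⟨-1, -1⟩], ![⟨0, -2⟩, 0, 0],
      ![-1, ⟨0, -1⟩, ⟨1, 1⟩], ![⟨1, 1⟩, -1, ⟨0, 1⟩]] i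
  | m i => ![![⟨0, 1⟩, ⟨1, 1⟩, -1], ![⟨0, -1⟩, ⟨1, 1⟩, -1], ![⟨-1, -1⟩, 1, ⟨0, 1⟩],
      ![0, 0, ⟨0, 2⟩], ![⟨1, 1⟩, 1, ⟨0, 1⟩]] i
  | t i => ![![⟨0, 1⟩, ⟨1, 1⟩, 1], ![0, ⟨0, 2⟩, 0], ![⟨0, -1⟩, ⟨1, 1⟩, 1],
      ![-1, ⟨0, 1⟩, ⟨1, 1⟩], ![1, ⟨0, 1⟩, ⟨1, 1⟩]] i

theorem stdVert_eq_goldenEmbedding (k : Vert) : stdVert k = goldenEmbedding (coord k) := by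
  obtain i | i | i | i := k <;> fin_cases i <;>
  · ext j
    fin_cases j <;>
      simp [stdVert, coord, goldenEmbedding, GoldenInt.toReal_apply, Real.goldenRatio_sq,
        QuadraticAlgebra.re_one, QuadraticAlgebra.im_one, add_comm]

theorem exists_eq_smul_linearIsometryEquiv_add {E : Type*} [NormedAddCommGroup E]
    [NormedSpace ℝ E] (f : E ≃ᵈ E) :
    ∃ (r : ℝ) (U : E ≃ₗᵢ[ℝ] E), 0 < r ∧ ∀ x, f x = r • U x + f 0 := by
  have hr : (0 : ℝ) < Dilation.ratio f := NNReal.coe_pos.2 (Dilation.ratio_pos f)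
  let g : E ≃ᵢ E := IsometryEquiv.mk
    (f.toEquiv.trans (MulAction.toPerm (Units.mk0 (Dilation.ratio f : ℝ)⁻¹
      (inv_ne_zero hr.ne')))) <|
    Isometry.of_dist_eq fun x y => by
      change dist ((Dilation.ratio f : ℝ)⁻¹ • f x) ((Dilation.ratio f : ℝ)⁻¹ • f y) = dist x y
      rw [dist_smul₀, Dilation.dist_eq, Real.norm_of_nonneg (inv_nonneg.2 hr.le),
        inv_mul_cancel_left₀ hr.ne']
  have hg (x : E) : g x = (Dilation.ratio f : ℝ)⁻¹ • f x := rfl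
  refine ⟨Dilation.ratio f, g.toRealLinearIsometryEquiv, hr, fun x => ?_⟩
  rw [IsometryEquiv.toRealLinearIsometryEquiv_apply, hg, hg, ← smul_sub, smul_inv_smul₀ hr.ne',
    sub_add_cancel]

/-- A similarity between the standard position of the rotunda and the position `v`, acting on
vectors; it describes the rotunda `v` by the coordinates of the standard one. -/
structure RotundaFrame (v : Vert → E3) where
  /-- The factor of the inner products. -/
  scale : ℝ
  scale_pos : 0 < scale
  /-- The vector with given coordinates. -/
  vec : GoldenVec →ₛₗ[GoldenInt.toReal] E3
  inner_vec (p q : GoldenVec) : inner ℝ (vec p) (vec q) = scale * (p ⬝ᵥ q).toReal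
  vec_coord_sub (k l : Vert) : vec (coord k - coord l) = v k - v l

theorem IsPentagonalRotunda.nonempty_frame {v : Vert → E3} (hv : IsPentagonalRotunda v) :
    Nonempty (RotundaFrame v) := by
  obtain ⟨f, hf⟩ := hv
  obtain ⟨r, U, hr, hU⟩ := exists_eq_smul_linearIsometryEquiv_add f
  refine ⟨⟨r ^ 2, by positivity, (r • U.toLinearEquiv.toLinearMap).comp goldenEmbedding,
    fun p q => ?_, fun k l => ?_⟩⟩
  · rw [← inner_goldenEmbedding, ← U.inner_map_map (goldenEmbedding p), sq, mul_assoc,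
      ← inner_smul_right, ← real_inner_smul_left]
    rfl
  · rw [hf, hf, hU, hU (stdVert l), add_sub_add_right_eq_sub, ← smul_sub, ← map_sub,
      stdVert_eq_goldenEmbedding, stdVert_eq_goldenEmbedding, ← map_sub]
    rfl

namespace RotundaFrame

variable {v : Vert → E3} (F : RotundaFrame v)

theorem inner_vec_sub (n : GoldenVec) (k l : Vert) :
    inner ℝ (F.vec n) (v k) - inner ℝ (F.vec n) (v l) =
      F.scale * ((n ⬝ᵥ coord k).toReal - (n ⬝ᵥ coord l).toReal) := by
  rw [← inner_sub_right, ← F.vec_coord_sub, F.inner_vec, dotProduct_sub, map_sub]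

theorem inner_vec_le_iff {n : GoldenVec} {k l : Vert} :
    inner ℝ (F.vec n) (v k) ≤ inner ℝ (F.vec n) (v l) ↔ n ⬝ᵥ coord k ≤ n ⬝ᵥ coord l := by
  rw [← sub_nonneg, F.inner_vec_sub, mul_nonneg_iff_of_pos_left F.scale_pos, sub_nonneg,
    GoldenInt.le_iff]

theorem inner_vec_lt_iff {n : GoldenVec} {k l : Vert} :
    inner ℝ (F.vec n) (v k) < inner ℝ (F.vec n) (v l) ↔ n ⬝ᵥ coord k < n ⬝ᵥ coord l := by
  rw [← sub_pos, F.inner_vec_sub, mul_pos_iff_of_pos_left F.scale_pos, sub_pos,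
    GoldenInt.lt_iff]

theorem inner_vec_eq_iff {n : GoldenVec} {k l : Vert} :
    inner ℝ (F.vec n) (v k) = inner ℝ (F.vec n) (v l) ↔ n ⬝ᵥ coord k = n ⬝ᵥ coord l := by
  rw [← sub_eq_zero, F.inner_vec_sub, mul_eq_zero_iff_left F.scale_pos.ne', sub_eq_zero,
    GoldenInt.toReal_injective.eq_iff]

theorem inner_vec_eq_zero_iff {p q : GoldenVec} :
    inner ℝ (F.vec p) (F.vec q) = 0 ↔ p ⬝ᵥ q = 0 := by
  rw [F.inner_vec, mul_eq_zero, or_iff_right F.scale_pos.ne',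
    map_eq_zero_iff _ GoldenInt.toReal_injective]

theorem vec_eq_zero_iff {p : GoldenVec} : F.vec p = 0 ↔ p = 0 := by
  rw [← inner_self_eq_zero (𝕜 := ℝ), F.inner_vec_eq_zero_iff,
    ← map_eq_zero_iff _ GoldenInt.toReal_injective, RingHom.map_dotProduct,
    dotProduct_self_eq_zero]
  exact ⟨fun h => funext fun i => GoldenInt.toReal_injective <|
    (congrFun h i).trans (map_zero _).symm, fun h => h ▸ funext fun _ => map_zero _⟩

theorem exists_eq_smul_vec {d e w : GoldenVec} (hd : d ⬝ᵥ w = 0) (he : e ⬝ᵥ w = 0)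
    (hdet : d ⬝ᵥ e ⨯₃ w ≠ 0) {x : E3} (hdx : inner ℝ (F.vec d) x = 0)
    (hex : inner ℝ (F.vec e) x = 0) : ∃ c : ℝ, x = c • F.vec w := by
  have hw : F.vec w ≠ 0 := fun h => by
    rw [triple_product_permutation, triple_product_permutation] at hdet
    exact hdet (F.inner_vec_eq_zero_iff.1 (by rw [h, inner_zero_left]))
  have hdual (i j : Fin 3) : inner ℝ (![F.vec d, F.vec e, F.vec w] i)
      (![F.vec (e ⨯₃ w), F.vec (w ⨯₃ d), F.vec w] j) = 0 ↔ i ≠ j := by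
    have hdet' : e ⬝ᵥ w ⨯₃ d ≠ 0 := triple_product_permutation d e w ▸ hdet
    fin_cases i <;> fin_cases j <;>
      simp [F.inner_vec_eq_zero_iff, hd, he, hdet, hdet', hw]
  have hx := eq_sum_of_dual (by simp) hdual x
  simp only [Fin.sum_univ_three, Matrix.cons_val, hdx, hex, zero_div, zero_smul, zero_add] at hx
  exact ⟨_, hx⟩

end RotundaFrame

deriving instance DecidableEq, Fintype for Vert
deriving instance DecidableEq, Fintype for CutName

/-- The faces of the rotunda: the base, the top pentagon, the pentagons and triangles at the base,
and the upper triangles `m i, t i, t (i + 1)`. -/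
inductive Side
  | base
  | top
  | pent (i : Fin 5)
  | tri (i : Fin 5)
  | up (i : Fin 5)
deriving DecidableEq, Fintype

open Side

/-- The outward normals of the faces of the standard rotunda. -/
def Side.normal : Side → GoldenVec
  | base => ![0, ⟨0, -1⟩, -1]
  | top => ![0, ⟨0, 1⟩, 1]
  | pent i => ![![⟨0, 1⟩, 1, 0], ![0, ⟨0, 1⟩, -1], ![⟨0, -1⟩, 1, 0], ![-1, 0, ⟨0, 1⟩],
      ![1, 0, ⟨0, 1⟩]] i
  | tri i => ![![1, 1, -1], ![-1, 1, -1], ![⟨0, -1⟩, 0, ⟨-1, 1⟩], ![0, ⟨1, -1⟩, ⟨0, 1⟩],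
      ![⟨0, 1⟩, 0, ⟨-1, 1⟩]] i
  | up i => ![![⟨-1, 1⟩, ⟨0, 1⟩, 0], ![⟨1, -1⟩, ⟨0, 1⟩, 0], ![-1, 1, 1], ![0, ⟨-1, 1⟩, ⟨0, 1⟩],
      ![1, 1, 1]] i

/-- A vertex of each face. -/
def Side.vert : Side → Vert
  | base => a 0
  | top => t 0
  | pent i => a i
  | tri i => b i
  | up i => m i

theorem Side.normal_dotProduct_le : ∀ (f : Side) (k : Vert),
    f.normal ⬝ᵥ coord k ≤ f.normal ⬝ᵥ coord f.vert := by
  decide +kernel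

theorem base_normal_dotProduct : ∀ k ∈ baseFace,
    base.normal ⬝ᵥ coord k = base.normal ⬝ᵥ coord (a 0) := by
  rintro _ (⟨i, rfl⟩ | ⟨i, rfl⟩) <;> revert i <;> decide +kernel

theorem pent_normal_dotProduct (i : Fin 5) : ∀ k ∈ pentagon i,
    (pent i).normal ⬝ᵥ coord k = (pent i).normal ⬝ᵥ coord (a i) := by
  simp only [pentagon, Set.mem_insert_iff, Set.mem_singleton_iff, forall_eq_or_imp, forall_eq]
  revert i
  decide +kernel

theorem tri_normal_dotProduct (i : Fin 5) : ∀ k ∈ triangle i,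
    (tri i).normal ⬝ᵥ coord k = (tri i).normal ⬝ᵥ coord (b i) := by
  simp only [triangle, Set.mem_insert_iff, Set.mem_singleton_iff, forall_eq_or_imp, forall_eq]
  revert i
  decide +kernel

/-- A normal of the plane of a path. -/
def pathNormal (i : Fin 5) : GoldenVec :=
  (coord (path i 0) - coord (path i 5)) ⨯₃ (coord (path i 1) - coord (path i 5))

theorem pathNormal_dotProduct (i : Fin 5) : ∀ k ∈ Set.range (path i),
    pathNormal i ⬝ᵥ coord k = pathNormal i ⬝ᵥ coord (path i 0) := by
  have h : ∀ i j, pathNormal i ⬝ᵥ coord (path i j) = pathNormal i ⬝ᵥ coord (path i 0) := by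
    decide +kernel
  rintro _ ⟨j, rfl⟩
  exact h i j

/-- The outward normals of the cutting planes, up to positive factors. The standard rotunda is half
of an icosidodecahedron with centre `0`, so the plane of the neighbours of a vertex is orthogonal to
the position vector of that vertex. -/
def cutNormal : CutName → GoldenVec
  | cut1start i => coord (path i 0) - coord (path i 5)
  | cut1stop i => coord (path i 5) - coord (path i 0)
  | cut2 i => -(pent i).normal
  | cut3 i => -(tri (i + 2)).normal
  | cut4m i => coord (m i)
  | cut4t i => coord (t i)

/-- Two directions that span the planes of the cuts with a given name. -/
def planeDirections : CutName → GoldenVec × GoldenVec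
  | cut1start i => (base.normal, pathNormal i)
  | cut1stop i => (base.normal, pathNormal i)
  | cut2 i => (coord (b i) - coord (a i), coord (m i) - coord (a i))
  | cut3 i => (coord (a (i + 3)) - coord (b (i + 2)), coord (m (i + 2)) - coord (b (i + 2)))
  | cut4m i => (coord (nbrM i 1) - coord (nbrM i 0), coord (nbrM i 3) - coord (nbrM i 0))
  | cut4t i => (coord (nbrT i 1) - coord (nbrT i 0), coord (nbrT i 3) - coord (nbrT i 0))

theorem planeDirections_dotProduct_cutNormal : ∀ c, (planeDirections c).1 ⬝ᵥ cutNormal c = 0 ∧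
    (planeDirections c).2 ⬝ᵥ cutNormal c = 0 ∧
    (planeDirections c).1 ⬝ᵥ (planeDirections c).2 ⨯₃ cutNormal c ≠ 0 := by
  decide +kernel

/-- The vertices `w 0, w 1, w 2, w 3` of the standard rotunda are the corners of a rectangle. -/
def IsCoordRectangle (w : Fin 4 → Vert) : Prop :=
  coord (w 1) - coord (w 0) = coord (w 2) - coord (w 3) ∧
    (coord (w 1) - coord (w 0)) ⬝ᵥ (coord (w 3) - coord (w 0)) = 0 ∧
    coord (w 1) ≠ coord (w 0) ∧ coord (w 3) ≠ coord (w 0)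

instance : DecidablePred IsCoordRectangle := fun _ => inferInstanceAs (Decidable (_ ∧ _))

theorem nbrM_isCoordRectangle : ∀ i, IsCoordRectangle (nbrM i) := by
  decide +kernel

theorem nbrT_isCoordRectangle : ∀ i, IsCoordRectangle (nbrT i) := by
  decide +kernel

theorem nbrM_triple_product_ne_zero : ∀ i, (coord (nbrM i 1) - coord (m i)) ⬝ᵥ
    (coord (nbrM i 2) - coord (m i)) ⨯₃ (coord (nbrM i 3) - coord (m i)) ≠ 0 := by
  decide +kernel

theorem nbrT_triple_product_ne_zero : ∀ i, (coord (nbrT i 1) - coord (t i)) ⬝ᵥ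
    (coord (nbrT i 2) - coord (t i)) ⨯₃ (coord (nbrT i 3) - coord (t i)) ≠ 0 := by
  decide +kernel

/-- The vertices removed by a cut. -/
def removed : CutName → Finset Vert
  | cut1start i => {path i 0}
  | cut1stop i => {path i 5}
  | cut2 i => {b (i + 2), a (i + 3)}
  | cut3 i => {a i, b i}
  | cut4m i => {m i}
  | cut4t i => {t i}

/-- A vertex removed by a cut. -/
def firstRemoved : CutName → Vert
  | cut1start i => path i 0
  | cut1stop i => path i 5
  | cut2 i => b (i + 2)
  | cut3 i => a i
  | cut4m i => m i
  | cut4t i => t i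

/-- A vertex nearest to the plane of a cut among those which the cut does not remove. -/
def firstKept : CutName → Vert
  | cut1start i => m i
  | cut1stop i => m (i + 2)
  | cut2 i => m (i + 2)
  | cut3 i => m i
  | cut4m i => b i
  | cut4t i => m i

theorem firstRemoved_mem : ∀ c, firstRemoved c ∈ removed c := by
  decide +kernel

theorem firstKept_notMem : ∀ c, firstKept c ∉ removed c := by
  decide +kernel

theorem cutNormal_dotProduct_firstKept_lt : ∀ c,
    cutNormal c ⬝ᵥ coord (firstKept c) < cutNormal c ⬝ᵥ coord (firstRemoved c) := by
  decide +kernel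

theorem cutNormal_dotProduct_of_mem_removed : ∀ c, ∀ k ∈ removed c,
    cutNormal c ⬝ᵥ coord k = cutNormal c ⬝ᵥ coord (firstRemoved c) := by
  decide +kernel

theorem cutNormal_dotProduct_le_firstKept : ∀ c, ∀ k ∉ removed c,
    cutNormal c ⬝ᵥ coord k ≤ cutNormal c ⬝ᵥ coord (firstKept c) := by
  decide +kernel

theorem cutNormal_dotProduct_nbrM : ∀ i j, cutNormal (cut4m i) ⬝ᵥ coord (nbrM i j) =
    cutNormal (cut4m i) ⬝ᵥ coord (firstKept (cut4m i)) := by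
  decide +kernel

theorem cutNormal_dotProduct_nbrT : ∀ i j, cutNormal (cut4t i) ⬝ᵥ coord (nbrT i j) =
    cutNormal (cut4t i) ⬝ᵥ coord (firstKept (cut4t i)) := by
  decide +kernel

theorem IsCut.removes {v : Vert → E3} {h : HalfSpace} {c : CutName} (hc : IsCut v h c) :
    Removes v h (removed c) := by
  cases c <;> simp only [removed, Finset.coe_singleton, Finset.coe_pair]
  exacts [hc.2.2, hc.2.2, hc.2, hc.2, hc.2, hc.2]

theorem eq_of_smul_add_smul_eq_of_linearIndependent {E : Type*} [AddCommGroup E] [Module ℝ E]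
    {x : Fin 4 → E} (hx : x 1 - x 0 = x 2 - x 3) (hli : LinearIndependent ℝ ![x 1, x 2, x 3])
    {s : Fin 4 → ℝ} (hs : s 0 • x 0 + s 2 • x 2 = s 1 • x 1 + s 3 • x 3) (j : Fin 4) :
    s j = s 0 := by
  have hsum : ∑ i, ![s 0 - s 1, s 2 - s 0, s 0 - s 3] i • ![x 1, x 2, x 3] i = 0 := by
    simp only [Fin.sum_univ_three, Matrix.cons_val]
    rw [← sub_eq_zero, ← sub_sub_cancel (x 1) (x 0), hx] at hs
    rw [← hs]
    module
  have h := Fintype.linearIndependent_iff.1 hli _ hsum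
  fin_cases j
  · rfl
  · exact (sub_eq_zero.1 (h 0)).symm
  · exact sub_eq_zero.1 (h 1)
  · exact (sub_eq_zero.1 (h 2)).symm

theorem CutsRectangle.inner_sub_eq_zero {v : Vert → E3} {h : HalfSpace} {k : Vert}
    {w : Fin 4 → Vert} (hr : CutsRectangle v h k w)
    (hw : v (w 1) - v (w 0) = v (w 2) - v (w 3))
    (hli : LinearIndependent ℝ ![v (w 1) - v k, v (w 2) - v k, v (w 3) - v k]) (j : Fin 4) :
    inner ℝ (v (w j) - v (w 0)) h.normal = 0 := by
  obtain ⟨q, hq, hq1, -, hne, -⟩ := hr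
  have hs (j : Fin 4) : ∃ s : ℝ, q j = v k + s • (v (w j) - v k) := by
    obtain ⟨s, -, hs⟩ := (segment_eq_image' ℝ (v k) (v (w j))).le (hq j).1
    exact ⟨s, hs.symm⟩
  choose s hs using hs
  have hs_eq := eq_of_smul_add_smul_eq_of_linearIndependent (s := s)
    (x := fun j => v (w j) - v k) (by simpa only [sub_sub_sub_cancel_right] using hw) hli (by
      rw [hs 0, hs 1, hs 2, hs 3, add_sub_add_left_eq_sub, add_sub_add_left_eq_sub,
        sub_eq_sub_iff_add_eq_add] at hq1
      rw [hq1, add_comm])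
  have hs0 : s 0 ≠ 0 := fun h0 => hne (by rw [hs, hs 0, hs_eq 1, h0, zero_smul, zero_smul])
  have hsub : q j - q 0 = s 0 • (v (w j) - v (w 0)) := by
    rw [hs, hs 0, hs_eq j, add_sub_add_left_eq_sub, ← smul_sub, sub_sub_sub_cancel_right]
  rw [real_inner_comm, ← smul_eq_zero_iff_right hs0, smul_eq_mul, ← inner_smul_right, ← hsub,
    inner_sub_right, (hq j).2, (hq 0).2, sub_self]

namespace RotundaFrame

variable {v : Vert → E3} (F : RotundaFrame v)

theorem linearIndependent_vec {d e w : GoldenVec} (h : d ⬝ᵥ e ⨯₃ w ≠ 0) :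
    LinearIndependent ℝ ![F.vec d, F.vec e, F.vec w] := by
  have h' : e ⬝ᵥ w ⨯₃ d ≠ 0 := triple_product_permutation d e w ▸ h
  have h'' : w ⬝ᵥ d ⨯₃ e ≠ 0 := triple_product_permutation e w d ▸ h'
  refine linearIndependent_of_dual (n := ![F.vec (e ⨯₃ w), F.vec (w ⨯₃ d), F.vec (d ⨯₃ e)])
    fun i j => ?_
  rw [real_inner_comm]
  fin_cases i <;> fin_cases j <;> simp [F.inner_vec_eq_zero_iff, h, h', h'']

theorem vec_mem_orthogonal_vectorSpan {S : Set Vert} {n : GoldenVec} {x : GoldenInt}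
    (hn : ∀ k ∈ S, n ⬝ᵥ coord k = x) : F.vec n ∈ (vectorSpan ℝ (v '' S))ᗮ := by
  rw [← Submodule.span_singleton_le_iff_mem, Submodule.le_orthogonal_iff_le_orthogonal]
  refine Submodule.span_le.2 ?_
  rintro _ ⟨_, ⟨k, hk, rfl⟩, _, ⟨l, hl, rfl⟩, rfl⟩
  rw [SetLike.mem_coe, Submodule.mem_orthogonal_singleton_iff_inner_right]
  exact (inner_sub_right _ _ _).trans <| sub_eq_zero.2 <|
    F.inner_vec_eq_iff.2 ((hn k hk).trans (hn l hl).symm)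

theorem vec_coord_sub_mem_vectorSpan {S : Set Vert} {k l : Vert} (hk : k ∈ S) (hl : l ∈ S) :
    F.vec (coord k - coord l) ∈ vectorSpan ℝ (v '' S) :=
  F.vec_coord_sub k l ▸
    vsub_mem_vectorSpan ℝ (Set.mem_image_of_mem v hk) (Set.mem_image_of_mem v hl)

theorem inner_vec_sub_eq_zero_of_parallelTo {h : HalfSpace} {S : Set Vert}
    (hS : ParallelTo v h S) {k l : Vert} (hk : k ∈ S) (hl : l ∈ S) :
    inner ℝ (F.vec (coord k - coord l)) h.normal = 0 :=
  Submodule.inner_right_of_mem_orthogonal (F.vec_coord_sub_mem_vectorSpan hk hl) hS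

theorem inner_vec_eq_zero_of_perpendicularTo {h : HalfSpace} {S : Set Vert}
    (hS : PerpendicularTo v h S) {n : GoldenVec} {x : GoldenInt}
    (hn : ∀ k ∈ S, n ⬝ᵥ coord k = x) : inner ℝ (F.vec n) h.normal = 0 :=
  Submodule.inner_left_of_mem_orthogonal hS (F.vec_mem_orthogonal_vectorSpan hn)

theorem inner_vec_sub_eq_zero_of_cutsRectangle {h : HalfSpace} {k : Vert} {w : Fin 4 → Vert}
    (hr : CutsRectangle v h k w)
    (hw : coord (w 1) - coord (w 0) = coord (w 2) - coord (w 3))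
    (hdet : (coord (w 1) - coord k) ⬝ᵥ (coord (w 2) - coord k) ⨯₃ (coord (w 3) - coord k) ≠ 0)
    (j : Fin 4) : inner ℝ (F.vec (coord (w j) - coord (w 0))) h.normal = 0 := by
  rw [F.vec_coord_sub]
  refine hr.inner_sub_eq_zero ?_ ?_ j
  · simpa only [F.vec_coord_sub] using congrArg F.vec hw
  · simpa only [F.vec_coord_sub] using F.linearIndependent_vec hdet

theorem inner_planeDirections_eq_zero {h : HalfSpace} {c : CutName} (hc : IsCut v h c) :
    inner ℝ (F.vec (planeDirections c).1) h.normal = 0 ∧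
      inner ℝ (F.vec (planeDirections c).2) h.normal = 0 := by
  cases c with
  | cut1start i | cut1stop i =>
    exact ⟨F.inner_vec_eq_zero_of_perpendicularTo hc.1 base_normal_dotProduct,
      F.inner_vec_eq_zero_of_perpendicularTo hc.2.1 (pathNormal_dotProduct i)⟩
  | cut2 i =>
    exact ⟨F.inner_vec_sub_eq_zero_of_parallelTo hc.1 (by simp [pentagon]) (by simp [pentagon]),
      F.inner_vec_sub_eq_zero_of_parallelTo hc.1 (by simp [pentagon]) (by simp [pentagon])⟩
  | cut3 i =>
    exact ⟨F.inner_vec_sub_eq_zero_of_parallelTo hc.1 (.inr (.inl (by rw [add_assoc]; rfl)))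
      (by simp [triangle]),
      F.inner_vec_sub_eq_zero_of_parallelTo hc.1 (by simp [triangle]) (by simp [triangle])⟩
  | cut4m i =>
    have hr := F.inner_vec_sub_eq_zero_of_cutsRectangle hc.1 (nbrM_isCoordRectangle i).1
      (nbrM_triple_product_ne_zero i)
    exact ⟨hr 1, hr 3⟩
  | cut4t i =>
    have hr := F.inner_vec_sub_eq_zero_of_cutsRectangle hc.1 (nbrT_isCoordRectangle i).1
      (nbrT_triple_product_ne_zero i)
    exact ⟨hr 1, hr 3⟩

theorem exists_normal_eq_smul_vec_cutNormal {h : HalfSpace} {c : CutName} (hc : IsCut v h c) :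
    ∃ r : ℝ, 0 < r ∧ h.normal = r • F.vec (cutNormal c) := by
  obtain ⟨h₁, h₂, hdet⟩ := planeDirections_dotProduct_cutNormal c
  obtain ⟨hn₁, hn₂⟩ := F.inner_planeDirections_eq_zero hc
  obtain ⟨r, hr⟩ := F.exists_eq_smul_vec h₁ h₂ hdet hn₁ hn₂
  refine ⟨r, ?_, hr⟩
  have hlt := (hc.removes.2 _ (firstKept_notMem c)).trans (hc.removes.1 _ (firstRemoved_mem c))
  rw [hr, real_inner_smul_left, real_inner_smul_left, ← sub_pos, ← mul_sub] at hlt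
  exact pos_of_mul_pos_left hlt
    (sub_nonneg.2 (F.inner_vec_lt_iff.2 (cutNormal_dotProduct_firstKept_lt c)).le)

end RotundaFrame

/-! ### Existence of truncations -/

namespace RotundaFrame

variable {v : Vert → E3} (F : RotundaFrame v)

theorem inner_vec_cutNormal_sub_pos (c : CutName) :
    0 < inner ℝ (F.vec (cutNormal c)) (v (firstRemoved c) - v (firstKept c)) := by
  rw [inner_sub_right, sub_pos, F.inner_vec_lt_iff]
  exact cutNormal_dotProduct_firstKept_lt c

/-- The normal of a cut, scaled such that `cutHeight` has the value `1` at the removed vertices. -/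
noncomputable def cutGradient (c : CutName) : E3 :=
  (inner ℝ (F.vec (cutNormal c)) (v (firstRemoved c) - v (firstKept c)))⁻¹ • F.vec (cutNormal c)

theorem inner_cutGradient_sub_eq_one (c : CutName) :
    inner ℝ (F.cutGradient c) (v (firstRemoved c) - v (firstKept c)) = 1 := by
  rw [cutGradient, real_inner_smul_left, inv_mul_cancel₀ (F.inner_vec_cutNormal_sub_pos c).ne']

theorem cutGradient_ne_zero (c : CutName) : F.cutGradient c ≠ 0 := fun h => by
  simpa [h] using F.inner_cutGradient_sub_eq_one c

/-- The affine function, constant on the planes of the cuts with the name `c`, that is `1` at the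
vertices they remove and has the maximum `0` at the vertices they keep. -/
noncomputable def cutHeight (c : CutName) : E3 →ᵃ[ℝ] ℝ :=
  (innerₛₗ ℝ (F.cutGradient c)).toAffineMap -
    AffineMap.const ℝ E3 (inner ℝ (F.cutGradient c) (v (firstKept c)))

theorem cutHeight_apply (c : CutName) (x : E3) :
    F.cutHeight c x = inner ℝ (F.cutGradient c) x - inner ℝ (F.cutGradient c) (v (firstKept c)) :=
  rfl

theorem cutHeight_le_cutHeight_iff {c : CutName} {k l : Vert} :
    F.cutHeight c (v k) ≤ F.cutHeight c (v l) ↔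
      cutNormal c ⬝ᵥ coord k ≤ cutNormal c ⬝ᵥ coord l := by
  rw [cutHeight_apply, cutHeight_apply, sub_le_sub_iff_right, cutGradient, real_inner_smul_left,
    real_inner_smul_left, mul_le_mul_iff_right₀ (inv_pos.2 (F.inner_vec_cutNormal_sub_pos c)),
    F.inner_vec_le_iff]

theorem cutHeight_eq_cutHeight {c : CutName} {k l : Vert}
    (h : cutNormal c ⬝ᵥ coord k = cutNormal c ⬝ᵥ coord l) :
    F.cutHeight c (v k) = F.cutHeight c (v l) :=
  (F.cutHeight_le_cutHeight_iff.2 h.le).antisymm (F.cutHeight_le_cutHeight_iff.2 h.ge)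

theorem cutHeight_firstKept (c : CutName) : F.cutHeight c (v (firstKept c)) = 0 := sub_self _

theorem cutHeight_of_mem_removed {c : CutName} {k : Vert} (hk : k ∈ removed c) :
    F.cutHeight c (v k) = 1 := by
  rw [F.cutHeight_eq_cutHeight (cutNormal_dotProduct_of_mem_removed c k hk), cutHeight_apply,
    ← inner_sub_right, inner_cutGradient_sub_eq_one]

theorem cutHeight_nonpos {c : CutName} {k : Vert} (hk : k ∉ removed c) :
    F.cutHeight c (v k) ≤ 0 := by
  rw [← F.cutHeight_firstKept c]
  exact F.cutHeight_le_cutHeight_iff.2 (cutNormal_dotProduct_le_firstKept c k hk)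

theorem cutHeight_le_one (c : CutName) (k : Vert) : F.cutHeight c (v k) ≤ 1 := by
  by_cases hk : k ∈ removed c
  · exact (F.cutHeight_of_mem_removed hk).le
  · exact (F.cutHeight_nonpos hk).trans zero_le_one

theorem cutHeight_add_cutHeight_le_one {c c' : CutName} (h : Disjoint (removed c) (removed c'))
    {x : E3} (hx : x ∈ solid v) : F.cutHeight c x + F.cutHeight c' x ≤ 1 := by
  refine convexHull_min ?_ ((convex_Iic (1 : ℝ)).affine_preimage
    (F.cutHeight c + F.cutHeight c')) hx
  rintro _ ⟨k, rfl⟩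
  change F.cutHeight c (v k) + F.cutHeight c' (v k) ≤ 1
  by_cases hk : k ∈ removed c
  · linarith [F.cutHeight_le_one c k, F.cutHeight_nonpos (Finset.disjoint_left.1 h hk)]
  · linarith [F.cutHeight_nonpos hk, F.cutHeight_le_one c' k]

/-- A cut at two thirds of the height. -/
noncomputable def standardCut (c : CutName) : HalfSpace where
  normal := F.cutGradient c
  normal_ne_zero := F.cutGradient_ne_zero c
  level := 2 / 3 + inner ℝ (F.cutGradient c) (v (firstKept c))

theorem removes_standardCut (c : CutName) : Removes v (F.standardCut c) (removed c) := by
  refine ⟨fun k hk => ?_, fun k hk => ?_⟩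
  · rw [standardCut, ← lt_sub_iff_add_lt, ← cutHeight_apply, F.cutHeight_of_mem_removed hk]
    norm_num
  · rw [standardCut, ← sub_lt_iff_lt_add, ← cutHeight_apply]
    exact (F.cutHeight_nonpos hk).trans_lt (by norm_num)

theorem disjoint_standardCut {c c' : CutName} (h : Disjoint (removed c) (removed c')) :
    Disjoint (solid v ∩ (F.standardCut c).coCarrier) (solid v ∩ (F.standardCut c').coCarrier) := by
  refine Set.disjoint_left.2 ?_
  rintro x ⟨hx, hc⟩ ⟨-, hc'⟩
  have hc : 2 / 3 ≤ F.cutHeight c x := le_sub_iff_add_le.2 hc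
  have hc' : 2 / 3 ≤ F.cutHeight c' x := le_sub_iff_add_le.2 hc'
  linarith [F.cutHeight_add_cutHeight_le_one h hx]

theorem cutsRectangle_standardCut {c : CutName} {k : Vert} {w : Fin 4 → Vert} (hk : k ∈ removed c)
    (hw : ∀ j, cutNormal c ⬝ᵥ coord (w j) = cutNormal c ⬝ᵥ coord (firstKept c))
    (hrect : IsCoordRectangle w) : CutsRectangle v (F.standardCut c) k w := by
  obtain ⟨h₁, h₂, h₃, h₄⟩ := hrect
  have hsub (i j : Fin 4) : AffineMap.lineMap (v k) (v (w i)) (1 / 3 : ℝ) -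
      AffineMap.lineMap (v k) (v (w j)) (1 / 3 : ℝ) =
        (1 / 3 : ℝ) • F.vec (coord (w i) - coord (w j)) := by
    rw [F.vec_coord_sub, AffineMap.lineMap_apply_module', AffineMap.lineMap_apply_module']
    module
  have hne (i j : Fin 4) (hij : coord (w i) ≠ coord (w j)) :
      AffineMap.lineMap (v k) (v (w i)) (1 / 3 : ℝ) ≠
        AffineMap.lineMap (v k) (v (w j)) (1 / 3 : ℝ) := by
    rw [← sub_ne_zero, hsub, smul_ne_zero_iff_right (by norm_num), Ne, F.vec_eq_zero_iff]
    exact sub_ne_zero.2 hij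
  refine ⟨fun j => AffineMap.lineMap (v k) (v (w j)) (1 / 3 : ℝ), fun j => ⟨?_, ?_⟩, ?_, ?_,
    hne 1 0 h₃, hne 3 0 h₄⟩
  · rw [segment_eq_image_lineMap]
    exact Set.mem_image_of_mem _ (by norm_num)
  · refine sub_eq_iff_eq_add.1 ((AffineMap.apply_lineMap (F.cutHeight c) _ _ _).trans ?_)
    rw [F.cutHeight_of_mem_removed hk, F.cutHeight_eq_cutHeight (hw j), F.cutHeight_firstKept,
      AffineMap.lineMap_apply_ring']
    norm_num
  · rw [hsub, hsub, h₁]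
  · rw [hsub, hsub, real_inner_smul_left, real_inner_smul_right, F.inner_vec_eq_zero_iff.2 h₂,
      mul_zero, mul_zero]

theorem isCut_standardCut (c : CutName) : IsCut v (F.standardCut c) c := by
  have hr := F.removes_standardCut c
  cases c with
  | cut1start i =>
    rw [removed, Finset.coe_singleton] at hr
    exact ⟨Submodule.smul_mem _ _
        (F.vec_coord_sub_mem_vectorSpan (.inr ⟨i, rfl⟩) (.inl ⟨i + 3, rfl⟩)),
      Submodule.smul_mem _ _ (F.vec_coord_sub_mem_vectorSpan ⟨0, rfl⟩ ⟨5, rfl⟩), hr⟩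
  | cut1stop i =>
    rw [removed, Finset.coe_singleton] at hr
    exact ⟨Submodule.smul_mem _ _
        (F.vec_coord_sub_mem_vectorSpan (.inl ⟨i + 3, rfl⟩) (.inr ⟨i, rfl⟩)),
      Submodule.smul_mem _ _ (F.vec_coord_sub_mem_vectorSpan ⟨5, rfl⟩ ⟨0, rfl⟩), hr⟩
  | cut2 i =>
    rw [removed, Finset.coe_pair] at hr
    exact ⟨Submodule.smul_mem _ _ (F.vec_mem_orthogonal_vectorSpan fun k hk =>
      (neg_dotProduct _ _).trans (congrArg Neg.neg (pent_normal_dotProduct i k hk))), hr⟩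
  | cut3 i =>
    rw [removed, Finset.coe_pair] at hr
    exact ⟨Submodule.smul_mem _ _ (F.vec_mem_orthogonal_vectorSpan fun k hk =>
      (neg_dotProduct _ _).trans (congrArg Neg.neg (tri_normal_dotProduct (i + 2) k hk))), hr⟩
  | cut4m i =>
    rw [removed, Finset.coe_singleton] at hr
    exact ⟨F.cutsRectangle_standardCut (by simp [removed]) (cutNormal_dotProduct_nbrM i)
      (nbrM_isCoordRectangle i), hr⟩
  | cut4t i =>
    rw [removed, Finset.coe_singleton] at hr
    exact ⟨F.cutsRectangle_standardCut (by simp [removed]) (cutNormal_dotProduct_nbrT i)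
      (nbrT_isCoordRectangle i), hr⟩

end RotundaFrame

theorem exists_isTruncation {v : Vert → E3} (hv : IsPentagonalRotunda v) {C : Set CutName}
    (hC : C.PairwiseDisjoint removed) : ∃ P, IsTruncation v C P := by
  obtain ⟨F⟩ := hv.nonempty_frame
  exact ⟨_, F.standardCut, fun c _ => F.isCut_standardCut c,
    fun c hc c' hc' hne => F.disjoint_standardCut (hC hc hc' hne), rfl⟩

/-! ### Truncations as simple polytopes -/

/-- The edges of the rotunda; the name of an edge starts with the types of its ends. -/
inductive Edge
  | ab (i : Fin 5)
  | ba (i : Fin 5)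
  | bm (i : Fin 5)
  | ma (i : Fin 5)
  | mt (i : Fin 5)
  | mt' (i : Fin 5)
  | tt (i : Fin 5)
deriving DecidableEq, Fintype

/-- The end points of an edge. -/
def Edge.ends : Edge → Vert × Vert
  | ab i => (a i, b i)
  | ba i => (b i, a (i + 1))
  | bm i => (b i, m i)
  | ma i => (m i, a (i + 1))
  | mt i => (m i, t i)
  | mt' i => (m i, t (i + 1))
  | tt i => (t i, t (i + 1))

/-- The two faces at an edge. -/
def Edge.sides : Edge → Side × Side
  | ab i => (base, pent i)
  | ba i => (base, tri i)
  | bm i => (pent i, tri i)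
  | ma i => (pent (i + 1), tri i)
  | mt i => (pent i, up i)
  | mt' i => (pent (i + 1), up i)
  | tt i => (top, up i)

/-- The edge `e` lies in the face `f`. -/
def Edge.OnSide (e : Edge) (f : Side) : Prop := e.sides.1 = f ∨ e.sides.2 = f

instance (e : Edge) (f : Side) : Decidable (e.OnSide f) := inferInstanceAs (Decidable (_ ∨ _))

theorem Edge.onSide_iff : ∀ (e : Edge) (f : Side), e.OnSide f ↔
    f.normal ⬝ᵥ coord e.ends.1 = f.normal ⬝ᵥ coord f.vert ∧
      f.normal ⬝ᵥ coord e.ends.2 = f.normal ⬝ᵥ coord f.vert := by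
  decide +kernel

theorem Edge.eq_of_onSide : ∀ e e' : Edge, e'.OnSide e.sides.1 → e'.OnSide e.sides.2 → e = e' := by
  decide +kernel

/-- An edge of the rotunda with a direction; `true` stands for the direction from the first to the
second entry of `Edge.ends`. -/
abbrev Dart : Type := Edge × Bool

/-- The start of a directed edge. -/
def Dart.src (d : Dart) : Vert := if d.2 then d.1.ends.1 else d.1.ends.2

/-- The end of a directed edge. -/
def Dart.tgt (d : Dart) : Vert := if d.2 then d.1.ends.2 else d.1.ends.1

/-- The directed edge with the opposite direction. -/
def Dart.rev (d : Dart) : Dart := (d.1, !d.2)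

theorem Dart.src_rev : ∀ d : Dart, d.rev.src = d.tgt
  | (_, false) => rfl
  | (_, true) => rfl

theorem Dart.tgt_rev : ∀ d : Dart, d.rev.tgt = d.src
  | (_, false) => rfl
  | (_, true) => rfl

theorem Dart.onSide_iff : ∀ (d : Dart) (f : Side), d.1.OnSide f ↔
    f.normal ⬝ᵥ coord d.src = f.normal ⬝ᵥ coord f.vert ∧
      f.normal ⬝ᵥ coord d.tgt = f.normal ⬝ᵥ coord f.vert
  | (e, false), f => (e.onSide_iff f).trans and_comm
  | (e, true), f => e.onSide_iff f

/-- The directed edges that leave the piece cut off at their start, if `κ p` is the cut that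
removes the vertex `p`; each of them contains one vertex of the truncation. -/
abbrev CutDart (κ : Vert → CutName) : Type := {d : Dart // κ d.src ≠ κ d.tgt}

namespace CutDart

variable {κ : Vert → CutName} (d d' : CutDart κ)

/-- The three facets of a truncation at its vertex on a directed edge. -/
def facets : Fin 3 → Side ⊕ Set.range κ :=
  ![.inr (Set.rangeFactorization κ d.1.src), .inl d.1.1.sides.1, .inl d.1.1.sides.2]

/-- The directed edge with the opposite direction. -/
def rev : CutDart κ := ⟨d.1.rev, by rw [Dart.src_rev, Dart.tgt_rev]; exact d.2.symm⟩

theorem exists_facets_eq_inl_iff (f : Side) : (∃ i, d.facets i = .inl f) ↔ d.1.1.OnSide f := by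
  simp [facets, Fin.exists_fin_succ, Edge.OnSide]

theorem exists_facets_eq_inr_iff (c : Set.range κ) :
    (∃ i, d.facets i = .inr c) ↔ κ d.1.src = c := by
  simp [facets, Fin.exists_fin_succ, Subtype.ext_iff, Set.rangeFactorization]

theorem exists_facets_eq_facets_iff (j : Fin 3) : (∃ k, d'.facets k = d.facets j) ↔
    ![κ d'.1.src = κ d.1.src, d'.1.1.OnSide d.1.1.sides.1, d'.1.1.OnSide d.1.1.sides.2] j := by
  fin_cases j
  exacts [d'.exists_facets_eq_inr_iff _, d'.exists_facets_eq_inl_iff _,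
    d'.exists_facets_eq_inl_iff _]

variable {d d'} in
theorem eq_of_facets (h : ∀ i, ∃ k, d'.facets k = d.facets i) : d = d' := by
  simp only [exists_facets_eq_facets_iff, Fin.forall_fin_succ, Fin.forall_fin_zero] at h
  obtain ⟨hsrc, h₁, h₂, -⟩ := h
  obtain ⟨⟨e, s⟩, hd⟩ := d
  obtain ⟨⟨e', s'⟩, hd'⟩ := d'
  obtain rfl := Edge.eq_of_onSide e e' h₁ h₂
  obtain rfl | hs := eq_or_ne s s'
  · rfl
  · obtain rfl : s' = !s := Bool.eq_not.2 hs.symm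
    exact absurd (hsrc.symm.trans (congrArg κ (Dart.src_rev (e, s)))) hd

end CutDart

/-- The cut `κ p` is the only one of the cuts `κ q` that removes the vertex `p` of the rotunda, and
the faces and cuts are incident with the directed edges in `CutDart κ` like the facets of a simple
polytope with its vertices. -/
structure IsCutSystem (κ : Vert → CutName) : Prop where
  mem_removed_iff (p q : Vert) : q ∈ removed (κ p) ↔ κ q = κ p
  exists_adjacent (d : Dart) : κ d.src ≠ κ d.tgt →
    (∃ d' : Dart, κ d'.src ≠ κ d'.tgt ∧ κ d'.src = κ d.src ∧ d'.1.OnSide d.1.sides.1 ∧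
      ¬d'.1.OnSide d.1.sides.2) ∧
    ∃ d' : Dart, κ d'.src ≠ κ d'.tgt ∧ κ d'.src = κ d.src ∧ d'.1.OnSide d.1.sides.2 ∧
      ¬d'.1.OnSide d.1.sides.1
  exists_dart_of_vert (p : Vert) : ∃ d : Dart, κ d.src ≠ κ d.tgt ∧ κ d.src = κ p
  exists_dart_of_side (f : Side) : ∃ d : Dart, κ d.src ≠ κ d.tgt ∧ d.1.OnSide f

namespace IsCutSystem

variable {κ : Vert → CutName} (hκ : IsCutSystem κ)
include hκ

theorem exists_cutDart_adjacent (d : CutDart κ) (i : Fin 3) :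
    ∃ d' : CutDart κ, ∀ j, (∃ k, d'.facets k = d.facets j) ↔ j ≠ i := by
  obtain ⟨⟨d₁, hd₁, hsrc₁, hside₁, hside₁'⟩, d₂, hd₂, hsrc₂, hside₂, hside₂'⟩ :=
    hκ.exists_adjacent d.1 d.2
  simp only [CutDart.exists_facets_eq_facets_iff, Fin.forall_fin_succ, Fin.forall_fin_zero]
  fin_cases i
  · have hedge : d.rev.1.1 = d.1.1 := rfl
    have hsrc : d.rev.1.src = d.1.tgt := d.1.src_rev
    exact ⟨d.rev, by simp [hsrc, d.2.symm, hedge, Edge.OnSide]⟩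
  · exact ⟨⟨d₂, hd₂⟩, by simp [hsrc₂, hside₂, hside₂']⟩
  · exact ⟨⟨d₁, hd₁⟩, by simp [hsrc₁, hside₁, hside₁']⟩

theorem exists_cutDart_facets_eq (f : Side ⊕ Set.range κ) :
    ∃ (d : CutDart κ) (i : Fin 3), d.facets i = f := by
  obtain f | ⟨_, p, rfl⟩ := f
  · obtain ⟨d, hd, hf⟩ := hκ.exists_dart_of_side f
    exact ⟨⟨d, hd⟩, (CutDart.exists_facets_eq_inl_iff _ f).2 hf⟩
  · obtain ⟨d, hd, hp⟩ := hκ.exists_dart_of_vert p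
    exact ⟨⟨d, hd⟩, (CutDart.exists_facets_eq_inr_iff _ _).2 hp⟩

theorem nonempty_cutDart : Nonempty (CutDart κ) :=
  (hκ.exists_cutDart_facets_eq (.inl base)).nonempty

theorem pairwiseDisjoint_removed : (Set.range κ).PairwiseDisjoint removed := by
  rintro _ ⟨p, rfl⟩ _ ⟨q, rfl⟩ hne
  refine Finset.disjoint_left.2 fun k hkp hkq => hne ?_
  rw [hκ.mem_removed_iff] at hkp hkq
  rw [← hkp, hkq]

end IsCutSystem

/-- The levels of planes, with the normals `cutNormal`, for the cuts of a cut system; each plane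
separates the vertices that it is to remove from the others, and the pieces cut off are disjoint. -/
structure CutLevels {v : Vert → E3} (F : RotundaFrame v) (κ : Vert → CutName) where
  /-- The level of the plane of a cut. -/
  level : CutName → ℝ
  level_lt_inner (p : Vert) : level (κ p) < inner ℝ (F.vec (cutNormal (κ p))) (v p)
  inner_lt_level (p q : Vert) : κ p ≠ κ q →
    inner ℝ (F.vec (cutNormal (κ q))) (v p) < level (κ q)
  inner_lt_level_of_le (p q : Vert) : κ p ≠ κ q → ∀ x ∈ solid v,
    level (κ p) ≤ inner ℝ (F.vec (cutNormal (κ p))) x →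
      inner ℝ (F.vec (cutNormal (κ q))) x < level (κ q)

theorem IsTruncation.exists_cutLevels {v : Vert → E3} (F : RotundaFrame v) {κ : Vert → CutName}
    (hκ : IsCutSystem κ) {P : Set E3} (hP : IsTruncation v (Set.range κ) P) :
    ∃ T : CutLevels F κ,
      P = solid v ∩ {x | ∀ p, inner ℝ (F.vec (cutNormal (κ p))) x ≤ T.level (κ p)} := by
  obtain ⟨h, hcut, hdisj, rfl⟩ := hP
  choose! r hr hn using fun c hc => F.exists_normal_eq_smul_vec_cutNormal (hcut c hc)
  have hle (p : Vert) (x : E3) : inner ℝ (h (κ p)).normal x ≤ (h (κ p)).level ↔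
      inner ℝ (F.vec (cutNormal (κ p))) x ≤ (h (κ p)).level / r (κ p) := by
    rw [le_div_iff₀' (hr _ ⟨p, rfl⟩), ← real_inner_smul_left, ← hn _ ⟨p, rfl⟩]
  have hge (p : Vert) (x : E3) : (h (κ p)).level ≤ inner ℝ (h (κ p)).normal x ↔
      (h (κ p)).level / r (κ p) ≤ inner ℝ (F.vec (cutNormal (κ p))) x := by
    rw [div_le_iff₀' (hr _ ⟨p, rfl⟩), ← real_inner_smul_left, ← hn _ ⟨p, rfl⟩]
  refine ⟨⟨fun c => (h c).level / r c, fun p => ?_, fun p q hpq => ?_, fun p q hpq x hx hpx => ?_⟩,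
    ?_⟩
  · rw [← not_le, ← hle, not_le]
    exact (hcut _ ⟨p, rfl⟩).removes.1 p ((hκ.mem_removed_iff p p).2 rfl)
  · rw [← not_le, ← hge, not_le]
    exact (hcut _ ⟨q, rfl⟩).removes.2 p fun hp => hpq ((hκ.mem_removed_iff q p).1 hp)
  · rw [← not_le, ← hge]
    exact fun hqx => Set.disjoint_left.1 (hdisj ⟨p, rfl⟩ ⟨q, rfl⟩ hpq)
      ⟨hx, (hge p x).2 hpx⟩ ⟨hx, hqx⟩
  · simp only [Set.biInter_range, HalfSpace.carrier, hle, Set.ofPred_forall]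

theorem RotundaFrame.inner_side_le {v : Vert → E3} (F : RotundaFrame v) (f : Side) {x : E3}
    (hx : x ∈ solid v) : inner ℝ (F.vec f.normal) x ≤ inner ℝ (F.vec f.normal) (v f.vert) := by
  refine convexHull_min ?_ (convex_halfSpace_le (innerₛₗ ℝ (F.vec f.normal)).isLinear _) hx
  rintro _ ⟨k, rfl⟩
  exact F.inner_vec_le_iff.2 (f.normal_dotProduct_le k)

namespace CutLevels

variable {v : Vert → E3} {F : RotundaFrame v} {κ : Vert → CutName} (T : CutLevels F κ)
  (d : CutDart κ)

theorem exists_point : ∃ x ∈ openSegment ℝ (v d.1.src) (v d.1.tgt),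
    inner ℝ (F.vec (cutNormal (κ d.1.src))) x = T.level (κ d.1.src) :=
  exists_mem_openSegment_inner_eq (T.level_lt_inner d.1.src)
    (T.inner_lt_level d.1.tgt d.1.src d.2.symm)

/-- The vertex of the truncation on a directed edge. -/
noncomputable def point : E3 := (T.exists_point d).choose

theorem point_mem_openSegment : T.point d ∈ openSegment ℝ (v d.1.src) (v d.1.tgt) :=
  (T.exists_point d).choose_spec.1

theorem inner_point_eq_level :
    inner ℝ (F.vec (cutNormal (κ d.1.src))) (T.point d) = T.level (κ d.1.src) :=
  (T.exists_point d).choose_spec.2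

theorem point_mem_solid : T.point d ∈ solid v :=
  (convex_convexHull ℝ (Set.range v)).openSegment_subset
    (subset_convexHull ℝ _ ⟨_, rfl⟩) (subset_convexHull ℝ _ ⟨_, rfl⟩)
    (T.point_mem_openSegment d)

theorem inner_cutNormal_point_lt {p : Vert} (hp : κ d.1.src ≠ κ p) :
    inner ℝ (F.vec (cutNormal (κ p))) (T.point d) < T.level (κ p) :=
  T.inner_lt_level_of_le _ _ hp _ (T.point_mem_solid d) (T.inner_point_eq_level d).ge

theorem inner_cutNormal_point_le (p : Vert) :
    inner ℝ (F.vec (cutNormal (κ p))) (T.point d) ≤ T.level (κ p) := by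
  by_cases hp : κ d.1.src = κ p
  · exact hp ▸ (T.inner_point_eq_level d).le
  · exact (T.inner_cutNormal_point_lt d hp).le

theorem inner_cutNormal_point_eq_iff (p : Vert) :
    inner ℝ (F.vec (cutNormal (κ p))) (T.point d) = T.level (κ p) ↔ κ d.1.src = κ p :=
  ⟨not_imp_not.1 fun hp => (T.inner_cutNormal_point_lt d hp).ne,
    fun hp => hp ▸ T.inner_point_eq_level d⟩

theorem inner_side_point_eq_iff (d : CutDart κ) (f : Side) :
    inner ℝ (F.vec f.normal) (T.point d) = inner ℝ (F.vec f.normal) (v f.vert) ↔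
      d.1.1.OnSide f := by
  rw [Dart.onSide_iff, inner_eq_iff_of_mem_openSegment
    (F.inner_side_le f (subset_convexHull ℝ _ ⟨_, rfl⟩))
    (F.inner_side_le f (subset_convexHull ℝ _ ⟨_, rfl⟩)) (T.point_mem_openSegment d),
    F.inner_vec_eq_iff, F.inner_vec_eq_iff]

/-- The truncation as a simple polytope. -/
noncomputable def polytope (hκ : IsCutSystem κ) :
    SimplePolytope (Fin 3) (Side ⊕ Set.range κ) (CutDart κ) E3 where
  normal := Sum.elim (fun f => F.vec f.normal) fun c => F.vec (cutNormal c)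
  level := Sum.elim (fun f => inner ℝ (F.vec f.normal) (v f.vert)) fun c => T.level c
  point := T.point
  facets := CutDart.facets
  card_eq_finrank := by simp
  inner_le d
    | .inl f => F.inner_side_le f (T.point_mem_solid d)
    | .inr ⟨_, p, rfl⟩ => T.inner_cutNormal_point_le d p
  inner_eq_iff d
    | .inl f => (T.inner_side_point_eq_iff d f).trans (d.exists_facets_eq_inl_iff f).symm
    | .inr ⟨_, p, rfl⟩ =>
      (T.inner_cutNormal_point_eq_iff d p).trans (d.exists_facets_eq_inr_iff ⟨_, p, rfl⟩).symm
  exists_adjacent := hκ.exists_cutDart_adjacent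
  eq_of_facets _ _ := CutDart.eq_of_facets
  exists_vertex := hκ.exists_cutDart_facets_eq

theorem body_polytope (hκ : IsCutSystem κ) : (T.polytope hκ).body =
    solid v ∩ {x | ∀ p, inner ℝ (F.vec (cutNormal (κ p))) x ≤ T.level (κ p)} := by
  have := hκ.nonempty_cutDart
  refine Set.Subset.antisymm (fun x hx => ⟨?_, fun p => hx (.inr ⟨_, p, rfl⟩)⟩) ?_
  · rw [SimplePolytope.body_eq_convexHull] at hx
    exact convexHull_min (Set.range_subset_iff.2 T.point_mem_solid) (convex_convexHull ℝ _) hx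
  · rintro x ⟨hx, hcut⟩ (f | ⟨_, p, rfl⟩)
    exacts [F.inner_side_le f hx, hcut p]

end CutLevels

/-! ### Chains of edges -/

theorem smul_eq_smul_add_smul_of_cross_dotProduct_eq_zero {R : Type*} [CommRing R]
    {p q r : Fin 3 → R} (h : p ⨯₃ q ⬝ᵥ r = 0) :
    (p ⨯₃ q ⬝ᵥ p ⨯₃ r) • q = (p ⨯₃ q ⬝ᵥ q ⨯₃ r) • p + (p ⨯₃ q ⬝ᵥ p ⨯₃ q) • r := by
  simp only [cross_apply, Matrix.vec3_dotProduct, Matrix.cons_val] at h ⊢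
  ext i
  fin_cases i <;>
    simp only [Pi.add_apply, Pi.smul_apply, smul_eq_mul, Fin.zero_eta, Fin.mk_one, Fin.reduceFinMk]
  · linear_combination -(p 1 * q 2 - p 2 * q 1) * h
  · linear_combination -(p 2 * q 0 - p 0 * q 2) * h
  · linear_combination -(p 0 * q 1 - p 1 * q 0) * h

/-- A decidable criterion for `IsBetween`: unless `r = -p`, the vectors `p`, `q`, `r` lie in a plane
and the angles from `p` to `q`, from `q` to `r` and from `p` to `r` have the same orientation. -/
def IsGoldenBetween (p q r : GoldenVec) : Prop :=
  r = -p ∨ p ⨯₃ q ⬝ᵥ r = 0 ∧ 0 ≤ p ⨯₃ q ⬝ᵥ q ⨯₃ r ∧ 0 < p ⨯₃ q ⬝ᵥ p ⨯₃ r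

instance (p q r : GoldenVec) : Decidable (IsGoldenBetween p q r) :=
  inferInstanceAs (Decidable (_ ∨ _))

theorem IsGoldenBetween.isBetween_vec {v : Vert → E3} (F : RotundaFrame v) {p q r : GoldenVec}
    (h : IsGoldenBetween p q r) : IsBetween (F.vec p) (F.vec q) (F.vec r) := by
  obtain rfl | ⟨hplane, hqr, hpr⟩ := h
  · exact .inl (map_neg F.vec p)
  have hcomb := congrArg F.vec (smul_eq_smul_add_smul_of_cross_dotProduct_eq_zero hplane)
  simp only [map_add, map_smulₛₗ] at hcomb
  rw [GoldenInt.le_iff, map_zero] at hqr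
  rw [GoldenInt.lt_iff, map_zero] at hpr
  have hself : 0 ≤ (p ⨯₃ q ⬝ᵥ p ⨯₃ q).toReal := by
    rw [RingHom.map_dotProduct]
    exact Finset.sum_nonneg fun i _ => mul_self_nonneg _
  refine .inr ⟨_, _, div_nonneg hqr hpr.le, div_nonneg hself hpr.le, ?_⟩
  rw [div_eq_inv_mul, div_eq_inv_mul, mul_smul, mul_smul, ← smul_add, ← hcomb,
    inv_smul_smul₀ hpr.ne']

/-- The outward normal, up to a positive factor, of a face or of a cut. -/
def facetNormal : Side ⊕ CutName → GoldenVec := Sum.elim Side.normal cutNormal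

/-- The three pairs of facets of a truncation at its vertex on a directed edge. -/
def CutDart.facetPairs {κ : Vert → CutName} (d : CutDart κ) : Multiset (Sym2 (Side ⊕ CutName)) :=
  {s(.inr (κ d.1.src), .inl d.1.1.sides.1), s(.inl d.1.1.sides.1, .inl d.1.1.sides.2),
    s(.inl d.1.1.sides.2, .inr (κ d.1.src))}

/-- The edges of a truncation, identified with the pairs of facets that they separate, are
partitioned into chains along which the facet normals make a half-turn. Since every edge has two
ends, it occurs twice among the pairs of facets at the vertices. -/
structure IsChainPartition (κ : Vert → CutName) (L : List (List (Side ⊕ CutName))) : Prop where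
  isHalfTurnWith : ∀ l ∈ L, IsHalfTurnWith IsGoldenBetween (l.map facetNormal)
  mem_range : ∀ l ∈ L, ∀ f ∈ l, ∃ g : Side ⊕ Vert, g.map id κ = f
  sum_facetPairs : ∑ d : CutDart κ, d.facetPairs =
    2 • (L.flatMap consecutivePairs : Multiset (Sym2 (Side ⊕ CutName)))

namespace CutLevels

variable {v : Vert → E3} {F : RotundaFrame v} {κ : Vert → CutName} (T : CutLevels F κ)
  (hκ : IsCutSystem κ)

theorem cornerPairs_polytope (d : CutDart κ) : (T.polytope hκ).cornerPairs d =
    d.facetPairs.map (Sym2.map fun f => F.vec (facetNormal f)) := rfl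

theorem isEquiprojective_body_polytope {L : List (List (Side ⊕ CutName))}
    (hL : IsChainPartition κ L) : IsEquiprojective L.length (T.polytope hκ).body := by
  have := hκ.nonempty_cutDart
  let N (f : Side ⊕ CutName) : E3 := F.vec (facetNormal f)
  rw [← List.length_map (List.map N)]
  refine (T.polytope hκ).isEquiprojective_length (List.forall_mem_map.2 fun l hl => ⟨?_, ?_⟩) ?_
  · have := (hL.isHalfTurnWith l hl).map F.vec (map_neg F.vec) fun _ _ _ h => h.isBetween_vec F
    rwa [List.map_map] at this
  · refine List.forall_mem_map.2 ?_
    intro f hf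
    obtain ⟨f | p, rfl⟩ := hL.mem_range l hl f hf
    · exact ⟨.inl f, rfl⟩
    · exact ⟨.inr ⟨κ p, p, rfl⟩, rfl⟩
  · have hpairs := congrArg (Multiset.mapAddMonoidHom (Sym2.map N)) hL.sum_facetPairs
    rw [map_sum, map_nsmul, Multiset.coe_mapAddMonoidHom, Multiset.map_coe,
      List.map_flatMap] at hpairs
    simp only [map_consecutivePairs] at hpairs
    rwa [List.flatMap_map, Finset.sum_congr rfl fun d _ => T.cornerPairs_polytope hκ d]

end CutLevels

theorem exists_isTruncation_and_isEquiprojective {κ : Vert → CutName} (hκ : IsCutSystem κ)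
    {L : List (List (Side ⊕ CutName))} (hL : IsChainPartition κ L) {v : Vert → E3}
    (hv : IsPentagonalRotunda v) : (∃ P, IsTruncation v (Set.range κ) P) ∧
      ∀ P, IsTruncation v (Set.range κ) P → IsEquiprojective L.length P := by
  refine ⟨exists_isTruncation hv hκ.pairwiseDisjoint_removed, fun P hP => ?_⟩
  obtain ⟨F⟩ := hv.nonempty_frame
  obtain ⟨T, rfl⟩ := hP.exists_cutLevels F hκ
  exact T.body_polytope hκ ▸ T.isEquiprojective_body_polytope hκ hL

/-- The chain from the base to the top through the `i`-th pentagon. -/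
def pentChain (i : Fin 5) : List (Side ⊕ CutName) :=
  [.inl base, .inl (pent i), .inr (cut4t i), .inl top]

/-- The chain from the top to the base through the `i`-th triangle. -/
def triChain (i : Fin 5) : List (Side ⊕ CutName) :=
  [.inl top, .inl (up i), .inr (cut4m i), .inl (tri i), .inl base]

/-- The chains at the pair of a cut2 and a cut3 at the ends of the paths `i` and `i + 2`. -/
def pairChains (i : Fin 5) : List (List (Side ⊕ CutName)) :=
  [[.inl base, .inr (cut2 i), .inl (tri (i + 2)), .inr (cut4m (i + 2)), .inl (up (i + 2)),
      .inl top],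
    [.inr (cut2 i), .inl (pent (i + 2)), .inl (up (i + 1)), .inr (cut4t (i + 1)), .inl (up i),
      .inl (pent i)],
    [.inr (cut2 i), .inl (pent (i + 3)), .inl (up (i + 3)), .inr (cut4t (i + 4)),
      .inl (up (i + 4)), .inl (pent i)],
    [.inl top, .inr (cut4t i), .inl (pent i), .inr (cut3 i), .inl base],
    [.inr (cut3 i), .inl (tri i), .inl (pent (i + 1)), .inr (cut4m (i + 1)),
      .inl (pent (i + 2)), .inl (tri (i + 2))],
    [.inr (cut3 i), .inl (tri (i + 4)), .inl (pent (i + 4)), .inr (cut4m (i + 3)),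
      .inl (pent (i + 3)), .inl (tri (i + 2))]]

/-- The chains at the two cuts cut1 at the ends of the path `i`. -/
def pathChains (i : Fin 5) : List (List (Side ⊕ CutName)) :=
  [[.inr (cut1stop i), .inl base, .inr (cut1start i)],
    [.inr (cut1start i), .inl (pent i), .inl (up (i + 4)), .inr (cut4t (i + 4)),
      .inl (up (i + 3)), .inl (pent (i + 3)), .inr (cut1stop i)],
    [.inr (cut1start i), .inl (tri i), .inl (pent (i + 1)), .inr (cut4m (i + 1)),
      .inl (pent (i + 2)), .inl (tri (i + 2)), .inr (cut1stop i)]]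

/-- The cut of the first truncation that removes a given vertex. -/
def firstSystem : Vert → CutName
  | a i => ![cut3 0, cut3 1, cut1stop 4, cut2 0, cut2 1] i
  | b i => ![cut3 0, cut3 1, cut2 0, cut2 1, cut1start 4] i
  | m i => cut4m i
  | t i => cut4t i

/-- The cut of the second truncation that removes a given vertex. -/
def secondSystem : Vert → CutName
  | a i => ![cut3 0, cut1stop 3, cut1stop 4, cut2 0, cut1stop 1] i
  | b i => ![cut3 0, cut1start 1, cut2 0, cut1start 3, cut1start 4] i
  | m i => cut4m i
  | t i => cut4t i

/-- The chains of the first truncation. -/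
def firstChains : List (List (Side ⊕ CutName)) :=
  [2, 3, 4].map pentChain ++ [4, 0, 1].map triChain ++ [0, 1].flatMap pairChains ++ pathChains 4

/-- The chains of the second truncation. -/
def secondChains : List (List (Side ⊕ CutName)) :=
  [1, 2, 3, 4].map pentChain ++ [3, 4, 0, 1].map triChain ++ pairChains 0 ++
    [1, 3, 4].flatMap pathChains

theorem isCutSystem_firstSystem : IsCutSystem firstSystem where
  mem_removed_iff := by decide +kernel
  exists_adjacent := by decide +kernel
  exists_dart_of_vert := by decide +kernel
  exists_dart_of_side := by decide +kernel

theorem isCutSystem_secondSystem : IsCutSystem secondSystem where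
  mem_removed_iff := by decide +kernel
  exists_adjacent := by decide +kernel
  exists_dart_of_vert := by decide +kernel
  exists_dart_of_side := by decide +kernel

theorem isChainPartition_firstChains : IsChainPartition firstSystem firstChains where
  isHalfTurnWith := by decide +kernel
  mem_range := by decide +kernel
  sum_facetPairs := by decide +kernel

theorem isChainPartition_secondChains : IsChainPartition secondSystem secondChains where
  isHalfTurnWith := by decide +kernel
  mem_range := by decide +kernel
  sum_facetPairs := by decide +kernel

theorem isFirstEquitruncatedRotunda_iff {v : Vert → E3} {P : Set E3} :
    IsFirstEquitruncatedRotunda v P ↔ IsTruncation v (Set.range firstSystem) P := by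
  have h : ∀ c : CutName, ((((c = cut2 0 ∨ c = cut3 0) ∨ c = cut2 1 ∨ c = cut3 1) ∨
      c = cut1start 4 ∨ c = cut1stop 4) ∨ (∃ i, cut4m i = c) ∨ ∃ i, cut4t i = c) ↔
      ∃ k, firstSystem k = c := by
    decide +kernel
  exact Iff.of_eq (congrArg (IsTruncation v · P) (Set.ext h))

theorem isSecondEquitruncatedRotunda_iff {v : Vert → E3} {P : Set E3} :
    IsSecondEquitruncatedRotunda v P ↔ IsTruncation v (Set.range secondSystem) P := by
  have h : ∀ c : CutName, ((((c = cut2 0 ∨ c = cut3 0) ∨ (c = cut1start 1 ∨ c = cut1stop 1) ∨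
      c = cut1start 3 ∨ c = cut1stop 3) ∨ c = cut1start 4 ∨ c = cut1stop 4) ∨
      (∃ i, cut4m i = c) ∨ ∃ i, cut4t i = c) ↔ ∃ k, secondSystem k = c := by
    decide +kernel
  exact Iff.of_eq (congrArg (IsTruncation v · P) (Set.ext h))

end EquiRotunda

theorem mainTheorem5 (v : EquiRotunda.Vert → EquiRotunda.E3)
    (hv : EquiRotunda.IsPentagonalRotunda v) :
    ((∃ P, EquiRotunda.IsFirstEquitruncatedRotunda v P) ∧
      ∀ P, EquiRotunda.IsFirstEquitruncatedRotunda v P → EquiRotunda.IsEquiprojective 21 P) ∧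
    ((∃ P, EquiRotunda.IsSecondEquitruncatedRotunda v P) ∧
      ∀ P, EquiRotunda.IsSecondEquitruncatedRotunda v P →
        EquiRotunda.IsEquiprojective 23 P) := by
  simp only [EquiRotunda.isFirstEquitruncatedRotunda_iff,
    EquiRotunda.isSecondEquitruncatedRotunda_iff]
  exact ⟨EquiRotunda.exists_isTruncation_and_isEquiprojective EquiRotunda.isCutSystem_firstSystem
      EquiRotunda.isChainPartition_firstChains hv,
    EquiRotunda.exists_isTruncation_and_isEquiprojective EquiRotunda.isCutSystem_secondSystem
      EquiRotunda.isChainPartition_secondChains hv⟩
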